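/- **Setting.** A *filtration* $\mathbb X$ is an infinite rooted ordered tree in which every vertex has finitely many children, with weights $w(v)>0$ such that the root has weight $1$ and every vertex $v$ that is not a leaf has at least two children, whose weights add up to $w(v)$. The root is identified with $[0,1)$ and, recursively, if $v$ is identified with $[a,a+w(v))$ and has the children $u_0,\dots,u_{m-1}$ from left to right, then $u_j$ is identified with $[a+P_j,a+P_{j+1})$, where $P_k=\sum_{i<k}w(u_i)$. For $1\le k\le m-1$ put $\phi_k(v,\cdot)=w(u_k)\mathbf 1_{[a,a+P_k)}-P_k\mathbf 1_{[a+P_k,a+P_{k+1})}$. Number the root by $0$, and then the vertices that are not the left-most child of their parent by $1,2,\dots$, level by level and from left to right in each level. Let $\psi_0=1$, and for $n\ge1$ let $\psi_n$ be $\phi_\ell(v,\cdot)$ divided by its $L^2([0,1))$ norm, if vertex number $n$ is the child $u_\ell$ of $v$. Let $\mathbb X_1,\mathbb X_2$ be two filtrations with systems $\psi_{n,1}$, $\psi_{n,2}$, let $\mathbb G\subseteq[0,1)^2$, and let $\nu^*$ be a probability measure on $\mathbb G$ such that $\nu^*(\mathbb G\cap(v_1\times v_2))=w(v_1)w(v_2)$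 for all vertices $v_1$ of $\mathbb X_1$, $v_2$ of $\mathbb X_2$ for which $v_1\times v_2$ meets $\mathbb G$. For $\mathbf k=(k_1,k_2)\in\mathbb Z_+^2$ let $\psi_{\mathbf k}(\mathbf x)=\psi_{k_1,1}(x_1)\psi_{k_2,2}(x_2)$, $\Omega=\{\mathbf k:\psi_{\mathbf k}|_{\mathbb G}\not\equiv0\}$ and $\hat f(\mathbf k)=\int_{\mathbb G}f\psi_{\mathbf k}\,d\nu^*$. Let $\|\cdot\|$ be the uniform norm on $\mathbb G$ and $\mathcal F$ the closure of $\mathrm{span}\{\psi_{\mathbf k}|_{\mathbb G}:\mathbf k\in\Omega\}$ in it. For $h:\mathbb Z_+^2\to\mathbb R$ let $\Delta_1h(\mathbf k)=h(k_1+1,k_2)-h(\mathbf k)$, $\Delta_2h(\mathbf k)=h(k_1,k_2+1)-h(\mathbf k)$ and $$\mathcal V(h)=\sup_{\mathbf k}|h(\mathbf k)|+\sup_{k_1}\sum_{k_2}|\Delta_2h(\mathbf k)|+\sup_{k_2}\sum_{k_1}|\Delta_1h(\mathbf k)|+\sum_{\mathbf k}|\Delta_1\Delta_2h(\mathbf k)|.$$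 Let $g_j:\Omega\to[0,1]$, $j\ge0$, be an admissible partition of unity: each $g_j$ has finite support, $g_0(\mathbf 0)=1$, $\sum_jg_j(\mathbf k)=1$ for $\mathbf k\in\Omega$, and for some integer $m^*\ge0$, $g_jg_{j'}=0$ whenever $|j-j'|>m^*$; extend $g_j$ by $0$ to $\mathbb Z_+^2$. Put $H_n=\sum_{j=0}^ng_j$, $\mathbb P_n=\mathrm{span}\{\psi_{\mathbf k}|_{\mathbb G}:\mathbf k\in\Omega,\ H_n(\mathbf k)>0\}$, $E_n(f)=\inf_{P\in\mathbb P_n}\|f-P\|$, $\sigma_n(f)=\sum_{\mathbf k\in\Omega}H_n(\mathbf k)\hat f(\mathbf k)\psi_{\mathbf k}$, $\tau_0(f)=\sigma_0(f)$, and $\tau_j(f)=\sigma_j(f)-\sigma_{j-1}(f)$ for $j\ge1$. Let $r\ge1$ be an integer and $\mu:\mathbb Z_+^2\to\mathbb R$ a multiplier sequence of order $r$: $\mu(\mathbf k)>0$ for every $\mathbf k$ with $|\mathbf k-\mathbf m|_\infty\le2$ for some $\mathbf m\in\Omega$, and, if $\mu_j$ equals $\mu$ on the support of $g_j$ and $0$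 elsewhere, and $\mu_j^{[-1]}$ equals $1/\mu_j$ where $\mu_j\ne0$ and $0$ elsewhere, then $\mathcal V(\mu_j)$ and $\mathcal V(\mu_j^{[-1]})^{-1}$ lie between constant positive multiples of $2^{jr}$, with constants independent of $j$. Write $\mathcal Du$ for a function on $\mathbb G$ with $\widehat{\mathcal Du}(\mathbf k)=\mu(\mathbf k)\hat u(\mathbf k)$ for all $\mathbf k$, and let $K(f,\delta)=\inf\{\|f-u\|+\delta^r\|\mathcal Du\|:u,\mathcal Du\in\mathcal F\}$. For $0<\rho\le\infty$ and $\gamma>0$ let $\mathsf b_{\rho,\gamma}$ be the set of sequences $\{a_n\}_{n\ge0}$ with $\sum_n2^{n\gamma\rho}|a_n|^\rho<\infty$ (with $\sup_n2^{n\gamma}|a_n|<\infty$ if $\rho=\infty$), and let $B_{\rho,\gamma}=\{f\in\mathcal F:\{E_n(f)\}_{n\ge0}\in\mathsf b_{\rho,\gamma}\}$. **Theorem.** Let $0<\rho\le\infty$ and $\gamma>0$, suppose that $\sup_{n\ge1}\mathcal V(H_n)<\infty$, and let $f\in\mathcal F$. The following are equivalent: 1. $f\in B_{\rho,\gamma}$;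 2. $\{\|\tau_j(f)\|\}_{j\ge0}\in\mathsf b_{\rho,\gamma}$; 3. $\{\|f-\sigma_n(f)\|\}_{n\ge0}\in\mathsf b_{\rho,\gamma}$. If moreover $\gamma<r$, they are also equivalent to 4. $\{K(f,2^{-j})\}_{j\ge0}\in\mathsf b_{\rho,\gamma}$. -/

import Mathlib

open MeasureTheory
open scoped ENNReal NNReal

noncomputable section

namespace DigraphHarmonic

/-! ### Filtrations (weighted trees) and tree polynomials -/

/-- An ordered weighted tree in which every vertex has finitely many children. Vertices are
addresses: the root is `[]`, and the children of `v`, from left to right, are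
`0 :: v, 1 :: v, …, (arity v - 1) :: v`. Only the addresses singled out by `TreeData.IsVertex` are
vertices of the tree; the values of `arity` and `w` at other addresses are irrelevant. -/
structure TreeData where
  arity : List ℕ → ℕ
  w : List ℕ → ℝ

namespace TreeData

variable (T : TreeData)

def IsVertex : List ℕ → Prop
  | [] => True
  | i :: v => i < T.arity v ∧ IsVertex v

/-- Left endpoint of the interval associated with a vertex. -/
def left : List ℕ → ℝ
  | [] => 0
  | i :: v => left v + ∑ k ∈ Finset.range i, T.w (k :: v)

/-- The subinterval `[a, a + w(v))` of `[0,1)` associated with the vertex `v`. -/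
def interval (v : List ℕ) : Set ℝ := Set.Ico (T.left v) (T.left v + T.w v)

/-- `P_k(v) = p_0 + ⋯ + p_{k-1}`, where `p_j` is the weight of the `j`-th child of `v`. -/
def cumWeight (v : List ℕ) (k : ℕ) : ℝ := ∑ j ∈ Finset.range k, T.w (j :: v)

/-- The local tree polynomials: `φ_0 = 1_v` and `φ_k = p_k 1_{J_k} - P_k 1_{I_k}` for `k ≥ 1`, with
`J_k = [a, a + P_k)` and `I_k = [a + P_k, a + P_{k+1})`, extended by `0` outside `v`. -/
def localPoly (v : List ℕ) : ℕ → ℝ → ℝ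
  | 0 => (T.interval v).indicator 1
  | k + 1 => fun x =>
      T.w ((k + 1) :: v) *
          (Set.Ico (T.left v) (T.left v + T.cumWeight v (k + 1))).indicator 1 x
        - T.cumWeight v (k + 1) *
          (Set.Ico (T.left v + T.cumWeight v (k + 1))
            (T.left v + T.cumWeight v (k + 2))).indicator 1 x

/-- The vertices at level `L`, from left to right. -/
def level : ℕ → List (List ℕ)
  | 0 => [[]]
  | L + 1 => (level L).flatMap fun v => (List.range (T.arity v)).map fun i => i :: v

/-- `C_0 = {root}`, and `C_L` for `L ≥ 1`: the vertices at level `L` that are not the left-most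
child of their parent, from left to right. -/
def lloLevel : ℕ → List (List ℕ)
  | 0 => [[]]
  | L + 1 => (T.level (L + 1)).filter fun u => u.head? ≠ some 0

/-- The concatenation of `C_0, C_1, …, C_L`. -/
def lloPrefix (L : ℕ) : List (List ℕ) := (List.range (L + 1)).flatMap T.lloLevel

/-- The vertex with number `n` in the leave-left-out enumeration. In an infinite filtration no
`C_L` is empty, so that `C_0, …, C_n` together have more than `n` elements and the default value
is never taken. -/
def lloVertex (n : ℕ) : List ℕ := (T.lloPrefix n).getD n []

/-- The tree polynomials before normalization: `ψ_0 = 1`, and `ψ_n = φ_ℓ(v, ·)` if the `n`-th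
vertex is the `ℓ`-th child of `v`. -/
def psi (n : ℕ) (x : ℝ) : ℝ :=
  match T.lloVertex n with
  | [] => 1
  | l :: v => T.localPoly v l x

/-- The tree polynomials, normalized in `L²([0,1))`. -/
def psiN (n : ℕ) (x : ℝ) : ℝ :=
  T.psi n x / Real.sqrt (∫ t in Set.Ico (0 : ℝ) 1, T.psi n t ^ 2)

end TreeData

/-- An infinite filtration. -/
structure Filtration extends TreeData where
  w_pos : ∀ v, toTreeData.IsVertex v → 0 < w v
  w_root : w [] = 1
  /-- A vertex which is not a leaf has at least two children. -/
  two_le_arity : ∀ v, toTreeData.IsVertex v → arity v ≠ 0 → 2 ≤ arity v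
  /-- The weights of the children of a non-leaf vertex add up to its weight. -/
  w_children : ∀ v, toTreeData.IsVertex v → arity v ≠ 0 →
    ∑ i ∈ Finset.range (arity v), w (i :: v) = w v
  infinite : {v | toTreeData.IsVertex v}.Infinite

/-! ### The digraph as a subset of the square -/

/-- A digraph represented by a pair of filtrations: the set `G ⊆ [0,1)²` of points that correspond
to the nodes of the digraph, and the probability measure `ν` on `G` which gives to the points of `G`
in `v₁ × v₂`, if there are any, the weight `w(v₁) w(v₂)`. -/
structure DigraphRep where
  X₁ : Filtration
  X₂ : Filtration
  G : Set (ℝ × ℝ)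
  G_subset : G ⊆ Set.Ico 0 1 ×ˢ Set.Ico 0 1
  ν : Measure G
  prob : IsProbabilityMeasure ν
  weight : ∀ v₁ v₂, X₁.IsVertex v₁ → X₂.IsVertex v₂ →
    (G ∩ X₁.interval v₁ ×ˢ X₂.interval v₂).Nonempty →
    ν {x | (x : ℝ × ℝ) ∈ X₁.interval v₁ ×ˢ X₂.interval v₂} = ENNReal.ofReal (X₁.w v₁ * X₂.w v₂)

/-- The uniform norm. -/
def supNorm {α : Type*} (f : α → ℝ) : ℝ≥0∞ := ⨆ x, ‖f x‖ₑ

namespace DigraphRep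

variable (D : DigraphRep)

/-- The tensor product tree polynomial `ψ_k`, restricted to `G`. -/
def psi (k : ℕ × ℕ) : D.G → ℝ := fun x => D.X₁.psiN k.1 x.1.1 * D.X₂.psiN k.2 x.1.2

/-- `Ω`: the multi-indices `k` for which `ψ_k` does not vanish identically on `G`. -/
def Omega : Set (ℕ × ℕ) := {k | D.psi k ≠ 0}

/-- `𝓕`: the uniform closure on `G` of the span of `ψ_k`, `k ∈ Ω`. -/
def F : Set (D.G → ℝ) :=
  {f | ∀ ε > 0, ∃ P ∈ Submodule.span ℝ (D.psi '' D.Omega), supNorm (f - P) ≤ ε}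

/-- The Fourier coefficients (they vanish for `k ∉ Ω`). -/
def coeff (f : D.G → ℝ) (k : ℕ × ℕ) : ℝ := ∫ x, f x * D.psi k x ∂D.ν

end DigraphRep

/-! ### Bi-sequences -/

def diff₁ (h : ℕ × ℕ → ℝ) (k : ℕ × ℕ) : ℝ := h (k.1 + 1, k.2) - h k

def diff₂ (h : ℕ × ℕ → ℝ) (k : ℕ × ℕ) : ℝ := h (k.1, k.2 + 1) - h k

/-- The Hardy–Krause type variation of a bi-sequence. -/
def variation (h : ℕ × ℕ → ℝ) : ℝ≥0∞ :=
  (⨆ k, ‖h k‖ₑ) + (⨆ k₁, ∑' k₂, ‖diff₂ h (k₁, k₂)‖ₑ) + (⨆ k₂, ∑' k₁, ‖diff₁ h (k₁, k₂)‖ₑ)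
    + ∑' k, ‖diff₁ (diff₂ h) k‖ₑ

/-- `{k : |k - m|_∞ ≤ 2 for some m ∈ S}`. -/
def enlarge (S : Set (ℕ × ℕ)) : Set (ℕ × ℕ) :=
  {k | ∃ m ∈ S, |(k.1 : ℤ) - m.1| ≤ 2 ∧ |(k.2 : ℤ) - m.2| ≤ 2}

/-- An admissible partition of unity on `Ω`; the sequences are extended by `0` outside `Ω`. -/
structure IsAdmissible (Ω : Set (ℕ × ℕ)) (g : ℕ → ℕ × ℕ → ℝ) : Prop where
  mem_Icc : ∀ j k, g j k ∈ Set.Icc (0 : ℝ) 1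
  eq_zero : ∀ j k, k ∉ Ω → g j k = 0
  zero_zero : g 0 (0, 0) = 1
  finite_support : ∀ j, (Function.support (g j)).Finite
  hasSum : ∀ k ∈ Ω, HasSum (fun j => g j k) 1
  almost_disjoint : ∃ m : ℕ, ∀ j j', j + m < j' → ∀ k, g j k * g j' k = 0

/-- `μ_j`: the restriction of `μ` to the support of `g_j`, with value `0` outside. -/
def restrictTo (g : ℕ → ℕ × ℕ → ℝ) (μ : ℕ × ℕ → ℝ) (j : ℕ) : ℕ × ℕ → ℝ :=
  (Function.support (g j)).indicator μ

/-- `h^{[-1]}`: the reciprocal where `h` is not `0`, and `0` elsewhere (as `0⁻¹ = 0`). -/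
def recip (h : ℕ × ℕ → ℝ) : ℕ × ℕ → ℝ := fun k => (h k)⁻¹

/-- A multiplier sequence of order `r`: positive on the enlargement of `Ω`, with `V(μ_j)` and
`1 / V(μ_j^{[-1]})` comparable to `2^{jr}`, uniformly in `j`. -/
structure IsMultiplier (Ω : Set (ℕ × ℕ)) (g : ℕ → ℕ × ℕ → ℝ) (r : ℕ) (μ : ℕ × ℕ → ℝ) : Prop where
  pos : ∀ k ∈ enlarge Ω, 0 < μ k
  equiv : ∃ c C : ℝ≥0, 0 < c ∧ ∀ j : ℕ,
    c * 2 ^ (j * r) ≤ variation (restrictTo g μ j) ∧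
    variation (restrictTo g μ j) ≤ C * 2 ^ (j * r) ∧
    c * 2 ^ (j * r) ≤ (variation (recip (restrictTo g μ j)))⁻¹ ∧
    (variation (recip (restrictTo g μ j)))⁻¹ ≤ C * 2 ^ (j * r)

/-- `H_n = g_0 + ⋯ + g_n`. -/
def partialSum (g : ℕ → ℕ × ℕ → ℝ) (n : ℕ) (k : ℕ × ℕ) : ℝ := ∑ j ∈ Finset.range (n + 1), g j k

/-- The (quasi-)norm `‖a‖_{ρ,γ}` of a sequence of numbers in `[0,∞]`. -/
def seqNorm (ρ : ℝ≥0∞) (γ : ℝ) (a : ℕ → ℝ≥0∞) : ℝ≥0∞ :=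
  if ρ = ∞ then ⨆ n : ℕ, (2 : ℝ≥0∞) ^ (n * γ) * a n
  else (∑' n : ℕ, (2 : ℝ≥0∞) ^ (n * γ * ρ.toReal) * a n ^ ρ.toReal) ^ (1 / ρ.toReal)

/-- `𝖻_{ρ,γ}`. -/
def seqSpace (ρ : ℝ≥0∞) (γ : ℝ) : Set (ℕ → ℝ≥0∞) := {a | seqNorm ρ γ a < ∞}

namespace DigraphRep

variable (D : DigraphRep)

/-- `ℙ_n`: the tree polynomials of degree at most `n` with respect to `g`. -/
def polys (g : ℕ → ℕ × ℕ → ℝ) (n : ℕ) : Submodule ℝ (D.G → ℝ) :=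
  Submodule.span ℝ (D.psi '' {k | k ∈ D.Omega ∧ 0 < partialSum g n k})

/-- The degree of approximation `E_n(f)`. -/
def degApprox (g : ℕ → ℕ × ℕ → ℝ) (n : ℕ) (f : D.G → ℝ) : ℝ≥0∞ :=
  ⨅ P ∈ D.polys g n, supNorm (f - P)

/-- The reconstruction operator `σ_n` (a finite sum, as the `g_j` have finite support). -/
def sigma (g : ℕ → ℕ × ℕ → ℝ) (n : ℕ) (f : D.G → ℝ) : D.G → ℝ :=
  ∑ᶠ k ∈ D.Omega, (partialSum g n k * D.coeff f k) • D.psi k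

/-- The analysis operator `τ_j`. -/
def tau (g : ℕ → ℕ × ℕ → ℝ) : ℕ → (D.G → ℝ) → (D.G → ℝ)
  | 0, f => D.sigma g 0 f
  | j + 1, f => D.sigma g (j + 1) f - D.sigma g j f

/-- The smoothness class `B_{ρ,γ}`. -/
def besov (g : ℕ → ℕ × ℕ → ℝ) (ρ : ℝ≥0∞) (γ : ℝ) : Set (D.G → ℝ) :=
  {f | f ∈ D.F ∧ (fun n => D.degApprox g n f) ∈ seqSpace ρ γ}

/-- `f'` is a derivative of `f` in the sense of the multiplier sequence `μ`. -/
def IsDerivative (μ : ℕ × ℕ → ℝ) (f f' : D.G → ℝ) : Prop :=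
  ∀ k, D.coeff f' k = μ k * D.coeff f k

/-- The `K`-functional: the infimum of `‖f - u‖ + δ^r ‖𝒟u‖` over all `u ∈ 𝓕` with `𝒟u ∈ 𝓕`. -/
def kFunctional (μ : ℕ × ℕ → ℝ) (r : ℕ) (f : D.G → ℝ) (δ : ℝ) : ℝ≥0∞ :=
  ⨅ (u ∈ D.F) (u' ∈ D.F) (_ : D.IsDerivative μ u u'),
    supNorm (f - u) + ENNReal.ofReal (δ ^ r) * supNorm u'

end DigraphRep

end DigraphHarmonic

end

/-! The whole theorem rests on one fact: a multiplier operator with finitely supported symbol `h` is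
bounded on `𝓕` in the uniform norm by `9 * variation h` (`supNorm_mult_le`). Behind it are three
observations.

In one variable, `φ_k` is the Haar step that replaces averaging over the first `k + 1` children by
averaging over the first `k` children and over the last one separately. The kernels of partial sums
therefore telescope: after complete generations they are averaging kernels of a partition, and an
incomplete generation adds the averages over some siblings and subtracts the average over their
union. All of them have L¹ norm at most `3` (`isDominated_kernel`).

The weights pass to the digraph because `ν` can never exceed the product weight on a rectangle,
while both are additive over children and agree on the whole square. So every rectangle carries
exactly its product weight (`real_rect`), integrals of products of step functions factor, the `ψ_k`
are orthonormal, `Ω` is everything, and rectangular partial sums have norm at most `3 * 3 = 9`.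
Double summation by parts writes a multiplier operator as a combination of rectangular partial sums
with coefficients `Δ₁Δ₂h`.

The rest is classical approximation theory. The `σ_n` are uniformly bounded and fix `ℙ_{n-m}`
(`sigma_eq_self`), so `f - σ_{n+m}(f)` is controlled by `E_n(f)`, and `f - σ_n(f)` by the tail of `∑
τ_j(f)`. The multiplier estimate applied to `μ_j^{[-1]}` and to `μ_j` gives a direct and an inverse
estimate for the K-functional. Discrete Hardy inequalities (`inLp_of_le_tsum`) transfer everything
to weighted sequence spaces: tails need `γ > 0`, heads need `γ < r`. -/

noncomputable section

namespace DigraphHarmonic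

/-! ### Indicators of vertices -/

namespace TreeData

variable (T : TreeData)

/-- The indicator function of the interval of a vertex. -/
def cell (v : List ℕ) : ℝ → ℝ := (T.interval v).indicator 1

/-- The indicator function of the union of the first `m` children of a vertex. -/
def firstCells (v : List ℕ) (m : ℕ) (x : ℝ) : ℝ := ∑ i ∈ Finset.range m, T.cell (i :: v) x

/-- The step functions of a tree: linear combinations of indicators of vertices. -/
def stepFun : Submodule ℝ (ℝ → ℝ) := Submodule.span ℝ (T.cell '' {v | T.IsVertex v})

lemma cell_nonneg (v : List ℕ) (x : ℝ) : 0 ≤ T.cell v x :=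
  Set.indicator_nonneg (fun _ _ => zero_le_one) x

lemma cell_mul_self (v : List ℕ) (x : ℝ) : T.cell v x * T.cell v x = T.cell v x := by
  by_cases h : x ∈ T.interval v <;> simp [cell, h]

lemma cell_of_mem {v : List ℕ} {x : ℝ} (h : x ∈ T.interval v) : T.cell v x = 1 := by
  simp [cell, h]

lemma cell_of_notMem {v : List ℕ} {x : ℝ} (h : x ∉ T.interval v) : T.cell v x = 0 := by
  simp [cell, h]

lemma left_cons (i : ℕ) (v : List ℕ) : T.left (i :: v) = T.left v + T.cumWeight v i := rfl

lemma cumWeight_succ (v : List ℕ) (k : ℕ) :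
    T.cumWeight v (k + 1) = T.cumWeight v k + T.w (k :: v) := Finset.sum_range_succ _ _

lemma interval_cons (i : ℕ) (v : List ℕ) :
    T.interval (i :: v) =
      Set.Ico (T.left v + T.cumWeight v i) (T.left v + T.cumWeight v (i + 1)) := by
  rw [interval, left_cons, cumWeight_succ, add_assoc]

lemma firstCells_succ (v : List ℕ) (m : ℕ) (x : ℝ) :
    T.firstCells v (m + 1) x = T.firstCells v m x + T.cell (m :: v) x :=
  Finset.sum_range_succ _ _

lemma cell_mem_stepFun {v : List ℕ} (hv : T.IsVertex v) : T.cell v ∈ T.stepFun :=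
  Submodule.subset_span ⟨v, hv, rfl⟩

/-- Children are formed by prepending an index, so the ancestors of an address are its suffixes. -/
lemma isVertex_of_suffix {u v : List ℕ} (h : u <:+ v) (hv : T.IsVertex v) : T.IsVertex u := by
  induction v with
  | nil => rw [List.suffix_nil.1 h]; trivial
  | cons i v ih =>
    rcases List.suffix_cons_iff.1 h with rfl | h
    · exact hv
    · exact ih h hv.2

end TreeData

/-! ### Tiling and nesting of the intervals of a filtration -/

namespace Filtration

variable (X : Filtration)

open TreeData

lemma arity_ne_zero {i : ℕ} {v : List ℕ} (h : X.IsVertex (i :: v)) : X.arity v ≠ 0 :=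
  (Nat.zero_lt_of_lt h.1).ne'

lemma cumWeight_arity {v : List ℕ} (hv : X.IsVertex v) (h : X.arity v ≠ 0) :
    X.cumWeight v (X.arity v) = X.w v := X.w_children v hv h

lemma child_w_pos {v : List ℕ} (hv : X.IsVertex v) {i : ℕ} (hi : i < X.arity v) :
    0 < X.w (i :: v) := X.w_pos _ ⟨hi, hv⟩

lemma cumWeight_mono {v : List ℕ} (hv : X.IsVertex v) {i j : ℕ} (hij : i ≤ j)
    (hj : j ≤ X.arity v) : X.cumWeight v i ≤ X.cumWeight v j := by
  refine Finset.sum_le_sum_of_subset_of_nonneg (Finset.range_subset_range.2 hij) fun k hk _ => ?_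
  exact (X.child_w_pos hv ((Finset.mem_range.1 hk).trans_le hj)).le

lemma cumWeight_nonneg {v : List ℕ} (hv : X.IsVertex v) {j : ℕ} (hj : j ≤ X.arity v) :
    0 ≤ X.cumWeight v j := by
  simpa [cumWeight] using X.cumWeight_mono hv (Nat.zero_le j) hj

lemma cumWeight_pos {v : List ℕ} (hv : X.IsVertex v) {j : ℕ} (h0 : 0 < j) (hj : j ≤ X.arity v) :
    0 < X.cumWeight v j := by
  obtain ⟨k, rfl⟩ := Nat.exists_eq_succ_of_ne_zero h0.ne'
  rw [Nat.succ_eq_add_one, cumWeight_succ]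
  exact add_pos_of_nonneg_of_pos (X.cumWeight_nonneg hv (by omega)) (X.child_w_pos hv (by omega))

/-- Consecutive half-open child intervals tile without gap or overlap. This turns the interval `J_k`
of `localPoly` into a sum of cells, after which only combinatorics of cells is needed. -/
lemma firstCells_eq_indicator {v : List ℕ} (hv : X.IsVertex v) {m : ℕ} (hm : m ≤ X.arity v)
    (x : ℝ) : X.firstCells v m x =
      (Set.Ico (X.left v) (X.left v + X.cumWeight v m)).indicator 1 x := by
  induction m with
  | zero => simp [firstCells, cumWeight]
  | succ m ih =>
    rw [firstCells_succ, ih (by omega), cell, interval_cons]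
    have h1 := X.cumWeight_nonneg hv (j := m) (by omega)
    have h2 := X.cumWeight_mono hv (Nat.le_succ m) hm
    rw [← Set.Ico_union_Ico_eq_Ico (a := X.left v) (b := X.left v + X.cumWeight v m)
        (c := X.left v + X.cumWeight v (m + 1)) (by linarith) (by simpa using h2),
      Set.indicator_union_of_disjoint (Set.disjoint_left.2 fun y hy hy' => hy.2.not_ge hy'.1)]

lemma sum_children_cell {v : List ℕ} (hv : X.IsVertex v) (h : X.arity v ≠ 0) (x : ℝ) :
    X.firstCells v (X.arity v) x = X.cell v x := by
  rw [X.firstCells_eq_indicator hv le_rfl, X.cumWeight_arity hv h]; rfl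

lemma firstCells_nonneg (v : List ℕ) (m : ℕ) (x : ℝ) : 0 ≤ X.firstCells v m x :=
  Finset.sum_nonneg fun _ _ => X.cell_nonneg _ _

lemma firstCells_le_one {v : List ℕ} (hv : X.IsVertex v) {m : ℕ} (hm : m ≤ X.arity v) (x : ℝ) :
    X.firstCells v m x ≤ 1 := by
  rw [X.firstCells_eq_indicator hv hm]
  exact Set.indicator_le_self' (fun _ _ => zero_le_one) x

lemma firstCells_mem_stepFun {v : List ℕ} (hv : X.IsVertex v) {m : ℕ} (hm : m ≤ X.arity v) :
    X.firstCells v m ∈ X.stepFun := by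
  have : X.firstCells v m = ∑ i ∈ Finset.range m, X.cell (i :: v) := by
    ext x; simp [firstCells]
  rw [this]
  refine Submodule.sum_mem _ fun i hi => X.cell_mem_stepFun ⟨?_, hv⟩
  exact (Finset.mem_range.1 hi).trans_le hm

lemma localPoly_succ {v : List ℕ} (hv : X.IsVertex v) {k : ℕ} (hk : k + 1 < X.arity v) (x : ℝ) :
    X.localPoly v (k + 1) x = X.w ((k + 1) :: v) * X.firstCells v (k + 1) x
      - X.cumWeight v (k + 1) * X.cell ((k + 1) :: v) x := by
  rw [X.firstCells_eq_indicator hv hk.le, cell, interval_cons]; rfl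

lemma interval_cons_subset {v : List ℕ} {i : ℕ} (h : X.IsVertex (i :: v)) :
    X.interval (i :: v) ⊆ X.interval v := by
  have h1 := X.cumWeight_nonneg h.2 h.1.le
  have h2 := X.cumWeight_mono h.2 (Nat.succ_le_of_lt h.1) le_rfl
  rw [X.cumWeight_arity h.2 (X.arity_ne_zero h)] at h2
  rw [interval_cons, interval]
  exact Set.Ico_subset_Ico (by linarith) (by simpa using h2)

lemma interval_subset_of_suffix {u v : List ℕ} (h : u <:+ v) (hv : X.IsVertex v) :
    X.interval v ⊆ X.interval u := by
  induction v with
  | nil => rw [List.suffix_nil.1 h]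
  | cons i v ih =>
    rcases List.suffix_cons_iff.1 h with rfl | h
    · exact subset_rfl
    · exact (X.interval_cons_subset hv).trans (ih h hv.2)

lemma disjoint_children {v : List ℕ} {i j : ℕ} (hi : X.IsVertex (i :: v))
    (hj : X.IsVertex (j :: v)) (hij : i ≠ j) :
    Disjoint (X.interval (i :: v)) (X.interval (j :: v)) := by
  wlog h : i < j generalizing i j
  · exact (this hj hi hij.symm (by omega)).symm
  have := X.cumWeight_mono hi.2 (Nat.succ_le_of_lt h) hj.1.le
  rw [interval_cons, interval_cons, Set.disjoint_left]
  intro x hx hx'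
  have h1 := hx.2
  have h2 := hx'.1
  simp only [Nat.succ_eq_add_one] at this
  linarith

/-- Two vertices are nested or disjoint; if the second one is a proper descendant of the first, it
lies below one of its children. -/
lemma nested_or_disjoint {u v : List ℕ} (hu : X.IsVertex u) (hv : X.IsVertex v) :
    u = v ∨ (∃ j, (j :: u) <:+ v) ∨ (∃ j, (j :: v) <:+ u) ∨
      Disjoint (X.interval u) (X.interval v) := by
  -- A proper ancestor can be prolonged by one letter: the last letter of the nonempty remainder
  -- `t`.
  have key : ∀ {a b : List ℕ}, a <:+ b → a ≠ b → ∃ j, (j :: a) <:+ b := by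
    rintro a b ⟨t, rfl⟩ hne
    induction t using List.reverseRecOn with
    | nil => simp at hne
    | append_singleton t j _ => exact ⟨j, t, by simp⟩
  induction u with
  | nil =>
    by_cases h : [] = v
    · exact Or.inl h
    · exact Or.inr (Or.inl (key List.nil_suffix h))
  | cons i u ih =>
    rcases ih hu.2 with rfl | ⟨j, hj⟩ | ⟨j, hj⟩ | h
    · exact Or.inr (Or.inr (Or.inl ⟨i, List.suffix_rfl⟩))
    · by_cases hij : i = j
      · subst hij
        by_cases h : i :: u = v
        · exact Or.inl h
        · exact Or.inr (Or.inl (key hj h))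
      · refine Or.inr (Or.inr (Or.inr ?_))
        exact (X.disjoint_children hu (X.isVertex_of_suffix hj hv) hij).mono_right
          (X.interval_subset_of_suffix hj hv)
    · exact Or.inr (Or.inr (Or.inl ⟨j, hj.trans (List.suffix_cons i u)⟩))
    · exact Or.inr (Or.inr (Or.inr (h.mono_left (X.interval_cons_subset hu))))

lemma cell_mul_of_suffix {u v : List ℕ} (h : u <:+ v) (hv : X.IsVertex v) :
    X.cell u * X.cell v = X.cell v := by
  ext x
  by_cases hx : x ∈ X.interval v
  · simp [X.cell_of_mem (X.interval_subset_of_suffix h hv hx)]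
  · simp [X.cell_of_notMem hx]

lemma cell_mul_of_disjoint {u v : List ℕ} (h : Disjoint (X.interval u) (X.interval v)) :
    X.cell u * X.cell v = 0 := by
  ext x
  by_cases hx : x ∈ X.interval v
  · simp [X.cell_of_notMem (Set.disjoint_right.1 h hx)]
  · simp [X.cell_of_notMem hx]

lemma cell_mul_mem {u v : List ℕ} (hu : X.IsVertex u) (hv : X.IsVertex v) :
    X.cell u * X.cell v ∈ X.stepFun := by
  rcases X.nested_or_disjoint hu hv with rfl | ⟨j, hj⟩ | ⟨j, hj⟩ | h
  · rw [X.cell_mul_of_suffix List.suffix_rfl hu]; exact X.cell_mem_stepFun hu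
  · rw [X.cell_mul_of_suffix ((List.suffix_cons j u).trans hj) hv]; exact X.cell_mem_stepFun hv
  · rw [mul_comm, X.cell_mul_of_suffix ((List.suffix_cons j v).trans hj) hu]
    exact X.cell_mem_stepFun hu
  · rw [X.cell_mul_of_disjoint h]; exact Submodule.zero_mem _

/-- Cells are nested or disjoint, so step functions form an algebra; the product formula for `ν`
thus applies to products of tree polynomials. -/
lemma mul_mem_stepFun {F H : ℝ → ℝ} (hF : F ∈ X.stepFun) (hH : H ∈ X.stepFun) :
    F * H ∈ X.stepFun := by
  induction hF, hH using Submodule.span_induction₂ with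
  | mem_mem x y hx hy =>
    obtain ⟨u, hu, rfl⟩ := hx
    obtain ⟨v, hv, rfl⟩ := hy
    exact X.cell_mul_mem hu hv
  | zero_left y hy => simp
  | zero_right x hx => simp
  | add_left x y z _ _ _ h1 h2 => rw [add_mul]; exact Submodule.add_mem _ h1 h2
  | add_right x y z _ _ _ h1 h2 => rw [mul_add]; exact Submodule.add_mem _ h1 h2
  | smul_left r x y _ _ h => rw [smul_mul_assoc]; exact Submodule.smul_mem _ _ h
  | smul_right r x y _ _ h => rw [mul_smul_comm]; exact Submodule.smul_mem _ _ h

/-! ### Integration of step functions over the unit interval -/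

lemma interval_root : X.interval [] = Set.Ico 0 1 := by
  simp [interval, left, X.w_root]

lemma interval_subset_unit {v : List ℕ} (hv : X.IsVertex v) : X.interval v ⊆ Set.Ico 0 1 := by
  rw [← X.interval_root]; exact X.interval_subset_of_suffix List.nil_suffix hv

lemma measurable_cell (v : List ℕ) : Measurable (X.cell v) :=
  measurable_one.indicator measurableSet_Ico

lemma integral_cell {v : List ℕ} (hv : X.IsVertex v) :
    ∫ x in Set.Ico (0 : ℝ) 1, X.cell v x = X.w v := by
  have h : MeasurableSet (X.interval v) := measurableSet_Ico
  rw [cell, integral_indicator_one h, Measure.real, Measure.restrict_apply h,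
    Set.inter_eq_left.2 (X.interval_subset_unit hv), interval, Real.volume_Ico,
    add_sub_cancel_left, ENNReal.toReal_ofReal (X.w_pos v hv).le]

lemma integrableOn_cell (v : List ℕ) : IntegrableOn (X.cell v) (Set.Ico (0 : ℝ) 1) :=
  (integrable_const (1 : ℝ)).indicator measurableSet_Ico

lemma stepFun_integrableOn {F : ℝ → ℝ} (hF : F ∈ X.stepFun) :
    IntegrableOn F (Set.Ico (0 : ℝ) 1) := by
  induction hF using Submodule.span_induction with
  | mem x hx => obtain ⟨v, -, rfl⟩ := hx; exact X.integrableOn_cell v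
  | zero => exact integrableOn_zero
  | add x y _ _ h1 h2 => exact h1.add h2
  | smul c x _ h => exact h.smul c

lemma stepFun_measurable {F : ℝ → ℝ} (hF : F ∈ X.stepFun) : Measurable F := by
  induction hF using Submodule.span_induction with
  | mem x hx => obtain ⟨v, -, rfl⟩ := hx; exact X.measurable_cell v
  | zero => exact measurable_const
  | add x y _ _ h1 h2 => exact h1.add h2
  | smul c x _ h => exact h.const_smul c

lemma integral_firstCells {v : List ℕ} (hv : X.IsVertex v) {m : ℕ} (hm : m ≤ X.arity v) :
    ∫ x in Set.Ico (0 : ℝ) 1, X.firstCells v m x = X.cumWeight v m := by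
  simp only [firstCells]
  rw [integral_finsetSum _ fun i _ => X.integrableOn_cell _]
  exact Finset.sum_congr rfl fun i hi =>
    X.integral_cell ⟨(Finset.mem_range.1 hi).trans_le hm, hv⟩

end Filtration

/-! ### Orthogonality of tree polynomials -/

namespace TreeData

variable (T : TreeData)

/-- The tree polynomial attached to a vertex, cut off outside `[0,1)`. -/
def polyAt : List ℕ → ℝ → ℝ
  | [] => T.cell []
  | l :: v => T.localPoly v l

/-- The square of the norm of the tree polynomial attached to a vertex. -/
def normSqAt : List ℕ → ℝ
  | [] => 1
  | l :: v => T.cumWeight v l * T.w (l :: v) * T.cumWeight v (l + 1)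

/-- The vertices which are not the left-most child of their parent, and the root. -/
def IsLlo (a : List ℕ) : Prop := T.IsVertex a ∧ a.head? ≠ some 0

end TreeData

namespace Filtration

variable (X : Filtration)

open TreeData

lemma isLlo_cons {l : ℕ} {v : List ℕ} (h : X.IsLlo (l :: v)) :
    ∃ k, l = k + 1 ∧ k + 1 < X.arity v ∧ X.IsVertex v := by
  obtain ⟨⟨h1, h2⟩, h3⟩ := h
  obtain ⟨k, rfl⟩ := Nat.exists_eq_succ_of_ne_zero (n := l) (by rintro rfl; simp at h3)
  exact ⟨k, rfl, h1, h2⟩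

lemma normSqAt_pos {a : List ℕ} (h : X.IsLlo a) : 0 < X.normSqAt a := by
  cases a with
  | nil => exact one_pos
  | cons l v =>
    obtain ⟨k, rfl, hk, hv⟩ := X.isLlo_cons h
    exact mul_pos (mul_pos (X.cumWeight_pos hv k.succ_pos hk.le) (X.child_w_pos hv hk))
      (X.cumWeight_pos hv (by omega) hk)

lemma localPoly_eq {v : List ℕ} (hv : X.IsVertex v) {k : ℕ} (hk : k + 1 < X.arity v) :
    X.localPoly v (k + 1) = X.w ((k + 1) :: v) • X.firstCells v (k + 1)
      - X.cumWeight v (k + 1) • X.cell ((k + 1) :: v) := by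
  ext x; simpa using X.localPoly_succ hv hk x

lemma polyAt_mem {a : List ℕ} (h : X.IsLlo a) : X.polyAt a ∈ X.stepFun := by
  cases a with
  | nil => exact X.cell_mem_stepFun h.1
  | cons l v =>
    obtain ⟨k, rfl, hk, hv⟩ := X.isLlo_cons h
    rw [polyAt, X.localPoly_eq hv hk]
    exact Submodule.sub_mem _ (Submodule.smul_mem _ _ (X.firstCells_mem_stepFun hv hk.le))
      (Submodule.smul_mem _ _ (X.cell_mem_stepFun ⟨hk, hv⟩))

lemma integral_polyAt_cons {l : ℕ} {v : List ℕ} (h : X.IsLlo (l :: v)) :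
    ∫ x in Set.Ico (0 : ℝ) 1, X.polyAt (l :: v) x = 0 := by
  obtain ⟨k, rfl, hk, hv⟩ := X.isLlo_cons h
  simp only [polyAt, X.localPoly_succ hv hk]
  rw [integral_sub ((X.stepFun_integrableOn (X.firstCells_mem_stepFun hv hk.le)).const_mul _)
    ((X.integrableOn_cell _).const_mul _), integral_const_mul, integral_const_mul,
    X.integral_firstCells hv hk.le, X.integral_cell h.1, mul_comm, sub_self]

lemma firstCells_mul_cell {v : List ℕ} (hv : X.IsVertex v) {m j : ℕ} (hm : m ≤ X.arity v)
    (hj : j < X.arity v) (x : ℝ) :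
    X.firstCells v m x * X.cell (j :: v) x = if j < m then X.cell (j :: v) x else 0 := by
  have key : ∀ i < X.arity v, X.cell (i :: v) x * X.cell (j :: v) x =
      if i = j then X.cell (j :: v) x else 0 := by
    intro i hi
    split_ifs with h
    · rw [h, cell_mul_self]
    · exact congrFun (X.cell_mul_of_disjoint
        (X.disjoint_children (i := i) (j := j) ⟨hi, hv⟩ ⟨hj, hv⟩ h)) x
  rw [firstCells, Finset.sum_mul,
    Finset.sum_congr rfl fun i hi => key i ((Finset.mem_range.1 hi).trans_le hm)]
  simp

lemma localPoly_mul_cell {v : List ℕ} (hv : X.IsVertex v) {k j : ℕ} (hk : k + 1 < X.arity v)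
    (hj : j < X.arity v) (x : ℝ) :
    X.localPoly v (k + 1) x * X.cell (j :: v) x =
      (if j < k + 1 then X.w ((k + 1) :: v) else if j = k + 1 then - X.cumWeight v (k + 1) else 0)
        * X.cell (j :: v) x := by
  rw [X.localPoly_succ hv hk, sub_mul, mul_assoc, mul_assoc, X.firstCells_mul_cell hv hk.le hj]
  have h1 := X.firstCells_mul_cell hv (m := k + 1) hk.le hj x
  -- The difference of the identities for `k + 2` and `k + 1` isolates the product of `cell ((k + 1)
  -- :: v)` with `cell (j :: v)`.
  have h2 := X.firstCells_mul_cell hv (m := k + 2) hk hj x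
  rw [firstCells_succ, add_mul, h1] at h2
  split_ifs at h2 ⊢ <;> first | omega | (simp at h2; simp [h2])

lemma localPoly_mul_root {v : List ℕ} (hv : X.IsVertex v) {k : ℕ} (hk : k + 1 < X.arity v)
    {u : List ℕ} (hu : u <:+ v) (x : ℝ) :
    X.cell u x * X.localPoly v (k + 1) x = X.localPoly v (k + 1) x := by
  have key : ∀ i < X.arity v, X.cell u x * X.cell (i :: v) x = X.cell (i :: v) x := fun i hi =>
    congrFun (X.cell_mul_of_suffix (hu.trans (List.suffix_cons i v)) ⟨hi, hv⟩) x
  rw [X.localPoly_succ hv hk, mul_sub, mul_left_comm, mul_left_comm (X.cell u x), key _ hk,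
    firstCells, Finset.mul_sum, Finset.sum_congr rfl fun i hi =>
      key i ((Finset.mem_range.1 hi).trans hk)]

/-- The polynomial with the smaller index lives on the first `l + 1` children, where the other one
is constant. -/
lemma localPoly_mul_same {v : List ℕ} (hv : X.IsVertex v) {k l : ℕ} (hkl : k < l)
    (hl : l + 1 < X.arity v) (x : ℝ) :
    X.localPoly v (l + 1) x * X.localPoly v (k + 1) x =
      X.w ((l + 1) :: v) * X.localPoly v (k + 1) x := by
  have key : ∀ i < l + 1, X.localPoly v (l + 1) x * X.cell (i :: v) x =
      X.w ((l + 1) :: v) * X.cell (i :: v) x := fun i hi => by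
    rw [X.localPoly_mul_cell hv hl (by omega), if_pos hi]
  rw [X.localPoly_succ hv (k := k) (by omega), mul_sub, mul_left_comm,
    mul_left_comm (X.localPoly v (l + 1) x), key _ (by omega),
    firstCells, Finset.mul_sum, Finset.sum_congr rfl fun i hi =>
      key i (by have := Finset.mem_range.1 hi; omega), ← Finset.mul_sum]
  ring

/-- The polynomial of the descendant is supported in a single child of `u`, and local polynomials
are constant on each child. -/
lemma localPoly_mul_below {u v : List ℕ} (hu : X.IsVertex u) (hv : X.IsVertex v) {j k l : ℕ}
    (hj : (j :: u) <:+ v) (hk : k + 1 < X.arity u) (hl : l + 1 < X.arity v) :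
    ∃ c : ℝ, ∀ x, X.localPoly u (k + 1) x * X.localPoly v (l + 1) x =
      c * X.localPoly v (l + 1) x := by
  exact ⟨_, fun x => by
    rw [← X.localPoly_mul_root hv hl hj, ← mul_assoc, X.localPoly_mul_cell hu hk
      (X.isVertex_of_suffix hj hv).1, mul_assoc]⟩

lemma localPoly_mul_disjoint {u v : List ℕ} (hu : X.IsVertex u) (hv : X.IsVertex v) {k l : ℕ}
    (h : Disjoint (X.interval u) (X.interval v)) (hk : k + 1 < X.arity u)
    (hl : l + 1 < X.arity v) (x : ℝ) :
    X.localPoly u (k + 1) x * X.localPoly v (l + 1) x = 0 := by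
  have h1 : X.cell u x * X.cell v x = 0 := congrFun (X.cell_mul_of_disjoint h) x
  rw [← X.localPoly_mul_root hu hk List.suffix_rfl, ← X.localPoly_mul_root hv hl List.suffix_rfl,
    mul_mul_mul_comm, h1, zero_mul]

/-- In every configuration one factor is constant on the support of the other, and the latter has
mean zero; for disjoint supports the constant can be taken to be `0`. -/
lemma integral_polyAt_mul {a b : List ℕ} (ha : X.IsLlo a) (hb : X.IsLlo b) (hab : a ≠ b) :
    ∫ x in Set.Ico (0 : ℝ) 1, X.polyAt a x * X.polyAt b x = 0 := by
  have key : ∀ {a : List ℕ} {l : ℕ} {v : List ℕ} (c : ℝ), X.IsLlo (l :: v) →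
      (∀ x, X.polyAt a x * X.polyAt (l :: v) x = c * X.polyAt (l :: v) x) →
      ∫ x in Set.Ico (0 : ℝ) 1, X.polyAt a x * X.polyAt (l :: v) x = 0 := by
    intro a l v c h hc
    simp only [hc]
    rw [integral_const_mul, X.integral_polyAt_cons h, mul_zero]
  have key' : ∀ {a : List ℕ} {l : ℕ} {v : List ℕ} (c : ℝ), X.IsLlo (l :: v) →
      (∀ x, X.polyAt a x * X.polyAt (l :: v) x = c * X.polyAt (l :: v) x) →
      ∫ x in Set.Ico (0 : ℝ) 1, X.polyAt (l :: v) x * X.polyAt a x = 0 := by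
    intro a l v c h hc
    simpa only [mul_comm] using key c h hc
  match a, b, ha, hb, hab with
  | [], [], _, _, hab => exact absurd rfl hab
  | [], m :: v, _, hb, _ =>
    refine key 1 hb fun x => ?_
    obtain ⟨l, rfl, hl, hv⟩ := X.isLlo_cons hb
    simpa [polyAt] using X.localPoly_mul_root hv hl List.nil_suffix x
  | n :: u, [], ha, _, _ =>
    refine key' 1 ha fun x => ?_
    obtain ⟨l, rfl, hl, hv⟩ := X.isLlo_cons ha
    simpa [polyAt] using X.localPoly_mul_root hv hl List.nil_suffix x
  | n :: u, m :: v, ha, hb, hab =>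
    obtain ⟨k, rfl, hk, hu⟩ := X.isLlo_cons ha
    obtain ⟨l, rfl, hl, hv⟩ := X.isLlo_cons hb
    rcases X.nested_or_disjoint hu hv with rfl | ⟨j, hj⟩ | ⟨j, hj⟩ | h
    · have hkl : k ≠ l := by rintro rfl; exact hab rfl
      rcases lt_or_gt_of_ne hkl with h | h
      · exact key' _ ha (X.localPoly_mul_same hu h hl)
      · exact key _ hb (X.localPoly_mul_same hu h hk)
    · obtain ⟨c, hc⟩ := X.localPoly_mul_below hu hv hj hk hl
      exact key c hb hc
    · obtain ⟨c, hc⟩ := X.localPoly_mul_below hv hu hj hl hk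
      exact key' c ha hc
    · exact key 0 hb fun x => by
        rw [zero_mul]; exact X.localPoly_mul_disjoint hu hv h hk hl x

lemma integral_polyAt_sq {a : List ℕ} (ha : X.IsLlo a) :
    ∫ x in Set.Ico (0 : ℝ) 1, X.polyAt a x * X.polyAt a x = X.normSqAt a := by
  cases a with
  | nil =>
    simp only [polyAt, cell_mul_self]
    rw [X.integral_cell ha.1, X.w_root, normSqAt]
  | cons l v =>
    obtain ⟨k, rfl, hk, hv⟩ := X.isLlo_cons ha
    have key : ∀ x, X.polyAt ((k + 1) :: v) x * X.polyAt ((k + 1) :: v) x =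
        X.w ((k + 1) :: v) ^ 2 * X.firstCells v (k + 1) x
          + X.cumWeight v (k + 1) ^ 2 * X.cell ((k + 1) :: v) x := by
      intro x
      have h1 : X.firstCells v (k + 1) x * X.firstCells v (k + 1) x = X.firstCells v (k + 1) x := by
        rw [X.firstCells_eq_indicator hv hk.le]
        by_cases h : x ∈ Set.Ico (X.left v) (X.left v + X.cumWeight v (k + 1)) <;> simp [h]
      have h2 := X.firstCells_mul_cell hv hk.le hk x
      rw [if_neg (by omega)] at h2
      have h3 := X.cell_mul_self ((k + 1) :: v) x
      simp only [polyAt, X.localPoly_succ hv hk]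
      linear_combination X.w ((k + 1) :: v) ^ 2 * h1 + X.cumWeight v (k + 1) ^ 2 * h3
        - 2 * X.w ((k + 1) :: v) * X.cumWeight v (k + 1) * h2
    simp only [key]
    rw [integral_add ((X.stepFun_integrableOn (X.firstCells_mem_stepFun hv hk.le)).const_mul _)
      ((X.integrableOn_cell _).const_mul _), integral_const_mul, integral_const_mul,
      X.integral_firstCells hv hk.le, X.integral_cell ha.1, normSqAt, cumWeight_succ _ _ (k + 1)]
    ring

end Filtration

/-! ### Kernels of partial sums -/

namespace TreeData

variable (T : TreeData)

/-- The reproducing kernel of the tree polynomials attached to a list of vertices. -/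
def kernelSum (p : List (List ℕ)) (x y : ℝ) : ℝ :=
  (p.map fun a => T.polyAt a x * T.polyAt a y / T.normSqAt a).sum

/-- The averaging kernel of a list of vertices. -/
def averageSum (q : List (List ℕ)) (x y : ℝ) : ℝ :=
  (q.map fun a => T.cell a x * T.cell a y / T.w a).sum

/-- The number of vertices of a list whose interval contains a point. -/
def coverCount (q : List (List ℕ)) (x : ℝ) : ℝ := (q.map fun a => T.cell a x).sum

def children (v : List ℕ) : List (List ℕ) := (List.range (T.arity v)).map fun i => i :: v

def lloChildren (v : List ℕ) : List (List ℕ) :=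
  (List.range (T.arity v - 1)).map fun i => (i + 1) :: v

def leaves (q : List (List ℕ)) : List (List ℕ) := q.filter fun v => T.arity v = 0

lemma kernelSum_append (p q : List (List ℕ)) (x y : ℝ) :
    T.kernelSum (p ++ q) x y = T.kernelSum p x y + T.kernelSum q x y := by simp [kernelSum]

lemma averageSum_append (p q : List (List ℕ)) (x y : ℝ) :
    T.averageSum (p ++ q) x y = T.averageSum p x y + T.averageSum q x y := by simp [averageSum]

lemma coverCount_append (p q : List (List ℕ)) (x : ℝ) :
    T.coverCount (p ++ q) x = T.coverCount p x + T.coverCount q x := by simp [coverCount]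

lemma coverCount_range (v : List ℕ) (m : ℕ) (x : ℝ) :
    T.coverCount ((List.range m).map fun i => i :: v) x = T.firstCells v m x := by
  induction m with
  | zero => simp [coverCount, firstCells]
  | succ m ih =>
    rw [List.range_succ, List.map_append, coverCount_append, ih, firstCells_succ]
    simp [coverCount]

lemma level_succ (L : ℕ) : T.level (L + 1) = (T.level L).flatMap T.children := rfl

lemma lloLevel_succ (L : ℕ) : T.lloLevel (L + 1) = (T.level L).flatMap T.lloChildren := by
  have key : ∀ v, (T.children v).filter (fun u => u.head? ≠ some 0) = T.lloChildren v := by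
    intro v
    rw [children, lloChildren, List.filter_map]
    cases h : T.arity v with
    | zero => simp
    | succ n => simp [List.range_succ_eq_map, List.filter_map, Function.comp_def]
  rw [lloLevel, level_succ, List.filter_flatMap]
  congr 1
  exact funext key

lemma lloPrefix_succ (L : ℕ) : T.lloPrefix (L + 1) = T.lloPrefix L ++ T.lloLevel (L + 1) := by
  rw [lloPrefix, List.range_succ, List.flatMap_append]; simp [lloPrefix]

end TreeData

/-! ### Telescoping of kernels and their L¹ bounds -/

namespace Filtration

variable (X : Filtration)

open TreeData

lemma level_isVertex {L : ℕ} {v : List ℕ} (h : v ∈ X.level L) : X.IsVertex v := by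
  induction L generalizing v with
  | zero => rw [List.mem_singleton.1 h]; trivial
  | succ L ih =>
    rw [level_succ, List.mem_flatMap] at h
    obtain ⟨u, hu, h⟩ := h
    obtain ⟨i, hi, rfl⟩ := List.mem_map.1 h
    exact ⟨List.mem_range.1 hi, ih hu⟩

lemma averageSum_mem {q : List (List ℕ)} (hq : ∀ a ∈ q, X.IsVertex a) (x : ℝ) :
    X.averageSum q x ∈ X.stepFun := by
  induction q with
  | nil => exact Submodule.zero_mem _
  | cons a q ih =>
    have : X.averageSum (a :: q) x = (X.cell a x / X.w a) • X.cell a + X.averageSum q x := by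
      ext y; simp [averageSum]; ring
    rw [this]
    exact Submodule.add_mem _ (Submodule.smul_mem _ _ (X.cell_mem_stepFun (hq a (by simp))))
      (ih fun b hb => hq b (by simp [hb]))

lemma averageSum_nonneg {q : List (List ℕ)} (hq : ∀ a ∈ q, X.IsVertex a) (x y : ℝ) :
    0 ≤ X.averageSum q x y := by
  refine List.sum_nonneg fun z hz => ?_
  obtain ⟨a, ha, rfl⟩ := List.mem_map.1 hz
  exact div_nonneg (mul_nonneg (X.cell_nonneg _ _) (X.cell_nonneg _ _)) (X.w_pos a (hq a ha)).le

lemma integral_averageSum {q : List (List ℕ)} (hq : ∀ a ∈ q, X.IsVertex a) (x : ℝ) :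
    ∫ y in Set.Ico (0 : ℝ) 1, X.averageSum q x y = X.coverCount q x := by
  induction q with
  | nil => simp [averageSum, coverCount]
  | cons a q ih =>
    have hq' : ∀ b ∈ q, X.IsVertex b := fun b hb => hq b (by simp [hb])
    have ha := hq a (by simp)
    have : ∀ y, X.averageSum (a :: q) x y
        = (X.cell a x / X.w a) * X.cell a y + X.averageSum q x y := by
      intro y; simp [averageSum]; ring
    simp only [this]
    rw [integral_add ((X.integrableOn_cell a).const_mul _)
      (X.stepFun_integrableOn (X.averageSum_mem hq' x)), ih hq', integral_const_mul,
      X.integral_cell ha, div_mul_cancel₀ _ (X.w_pos a ha).ne']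
    simp [coverCount]

/-- Each `φ_k ⊗ φ_k`, divided by its norm squared, equals the averages over `J_k` and `I_k` minus
the average over their union `J_{k+1}`. The averages over the intermediate unions cancel in the sum.
-/
lemma kernelSum_siblings {v : List ℕ} (hv : X.IsVertex v) {m : ℕ} (hm : m + 1 ≤ X.arity v)
    (x y : ℝ) :
    X.kernelSum ((List.range m).map fun i => (i + 1) :: v) x y =
      X.averageSum ((List.range (m + 1)).map fun i => i :: v) x y
        - X.firstCells v (m + 1) x * X.firstCells v (m + 1) y / X.cumWeight v (m + 1) := by
  induction m with
  | zero => simp [kernelSum, averageSum, firstCells, cumWeight]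
  | succ m ih =>
    rw [List.range_succ, List.map_append, kernelSum_append, ih (by omega),
      List.range_succ (n := m + 1), List.map_append, averageSum_append,
      firstCells_succ _ _ (m + 1), firstCells_succ _ _ (m + 1), cumWeight_succ _ _ (m + 1)]
    simp only [kernelSum, averageSum, List.map_cons, List.map_nil, List.sum_cons, List.sum_nil,
      polyAt, X.localPoly_succ hv hm, normSqAt, cumWeight_succ _ _ (m + 1)]
    have h1 := X.cumWeight_pos hv (j := m + 1) (by omega) (by omega)
    have h2 := X.child_w_pos hv (i := m + 1) hm
    have h3 : X.cumWeight v (m + 1) + X.w ((m + 1) :: v) ≠ 0 := by positivity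
    generalize X.cumWeight v (m + 1) = P at *
    generalize X.w ((m + 1) :: v) = W at *
    field_simp
    ring

/-- With all siblings present the subtracted union is `v` itself, so the average over `v` is
replaced by those over its children. A leaf has nothing to be replaced by and is kept. -/
lemma kernelSum_lloChildren {v : List ℕ} (hv : X.IsVertex v) (x y : ℝ) :
    X.averageSum [v] x y + X.kernelSum (X.lloChildren v) x y =
      X.averageSum (X.leaves [v] ++ X.children v) x y := by
  by_cases h : X.arity v = 0
  · simp [leaves, lloChildren, children, h, kernelSum]
  · have h1 : X.arity v - 1 + 1 = X.arity v := by omega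
    rw [lloChildren, X.kernelSum_siblings hv h1.le, h1, X.sum_children_cell hv h,
      X.sum_children_cell hv h, X.cumWeight_arity hv h]
    simp [leaves, children, h, averageSum]

lemma coverCount_children {v : List ℕ} (hv : X.IsVertex v) (x : ℝ) :
    X.coverCount (X.leaves [v] ++ X.children v) x = X.coverCount [v] x := by
  by_cases h : X.arity v = 0
  · simp [leaves, children, h]
  · rw [coverCount_append, children, coverCount_range, X.sum_children_cell hv h]
    simp [leaves, h, coverCount]

lemma kernelSum_generation {t : List (List ℕ)} (ht : ∀ v ∈ t, X.IsVertex v) (x y : ℝ) :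
    X.averageSum t x y + X.kernelSum (t.flatMap X.lloChildren) x y =
      X.averageSum (X.leaves t) x y + X.averageSum (t.flatMap X.children) x y := by
  induction t with
  | nil => simp [averageSum, kernelSum, leaves]
  | cons v t ih =>
    have h1 := X.kernelSum_lloChildren (ht v (by simp)) x y
    have h2 := ih fun b hb => ht b (by simp [hb])
    have h3 : X.leaves (v :: t) = X.leaves [v] ++ X.leaves t := by
      rw [leaves, leaves, leaves, ← List.filter_append]; rfl
    rw [averageSum_append] at h1
    rw [List.flatMap_cons, List.flatMap_cons, kernelSum_append, averageSum_append, h3,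
      averageSum_append, ← List.singleton_append, averageSum_append]
    linarith

lemma coverCount_generation {t : List (List ℕ)} (ht : ∀ v ∈ t, X.IsVertex v) (x : ℝ) :
    X.coverCount (X.leaves t) x + X.coverCount (t.flatMap X.children) x =
      X.coverCount t x := by
  induction t with
  | nil => simp [coverCount, leaves]
  | cons v t ih =>
    have h1 := X.coverCount_children (ht v (by simp)) x
    have h2 := ih fun b hb => ht b (by simp [hb])
    have h3 : X.leaves (v :: t) = X.leaves [v] ++ X.leaves t := by
      rw [leaves, leaves, leaves, ← List.filter_append]; rfl
    rw [coverCount_append] at h1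
    rw [List.flatMap_cons, coverCount_append, h3, coverCount_append,
      ← List.singleton_append (l := t), coverCount_append]
    linarith

/-- Functions dominated by a step function with integral at most `3`. -/
def IsDominated (F : ℝ → ℝ) : Prop :=
  ∃ M ∈ X.stepFun, (∀ y, |F y| ≤ M y) ∧ ∫ y in Set.Ico (0 : ℝ) 1, M y ≤ 3

lemma isDominated_averageSum {q : List (List ℕ)} (hq : ∀ a ∈ q, X.IsVertex a) {x : ℝ}
    (hx : X.coverCount q x ≤ 1) : X.IsDominated (X.averageSum q x) := by
  refine ⟨_, X.averageSum_mem hq x, fun y => (abs_of_nonneg (X.averageSum_nonneg hq x y)).le, ?_⟩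
  rw [X.integral_averageSum hq]; linarith

lemma isDominated_siblings {q : List (List ℕ)} (hq : ∀ a ∈ q, X.IsVertex a) {x : ℝ}
    (hx : X.coverCount q x ≤ 1) {v : List ℕ} (hv : X.IsVertex v) {m : ℕ}
    (hm : m + 1 ≤ X.arity v) :
    X.IsDominated fun y => X.averageSum q x y +
      X.kernelSum ((List.range m).map fun i => (i + 1) :: v) x y := by
  set s := (List.range (m + 1)).map fun i => i :: v with hs_def
  have hs : ∀ a ∈ s, X.IsVertex a := by
    intro a ha
    obtain ⟨i, hi, rfl⟩ := List.mem_map.1 ha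
    exact ⟨(List.mem_range.1 hi).trans_le hm, hv⟩
  have hP := X.cumWeight_pos hv (Nat.succ_pos m) hm
  have h0 := X.firstCells_nonneg v (m + 1)
  set c := X.firstCells v (m + 1) x / X.cumWeight v (m + 1)
  have hJ := X.firstCells_mem_stepFun hv hm
  -- The bound adds three nonnegative terms instead of subtracting the last: the old averages, those
  -- over the siblings, and the one over the union of the siblings. Each has integral at most `1`,
  -- whence the `3`.
  refine ⟨X.averageSum q x + X.averageSum s x + c • X.firstCells v (m + 1),
    Submodule.add_mem _ (Submodule.add_mem _ (X.averageSum_mem hq x) (X.averageSum_mem hs x))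
      (Submodule.smul_mem _ _ hJ), fun y => ?_, ?_⟩
  · beta_reduce
    rw [X.kernelSum_siblings hv hm]
    have h1 := X.averageSum_nonneg hq x y
    have h2 := X.averageSum_nonneg hs x y
    have h3 : 0 ≤ c * X.firstCells v (m + 1) y := mul_nonneg (div_nonneg (h0 x) hP.le) (h0 y)
    have h4 : X.firstCells v (m + 1) x * X.firstCells v (m + 1) y / X.cumWeight v (m + 1) =
      c * X.firstCells v (m + 1) y := by ring
    rw [h4]
    simp only [Pi.add_apply, Pi.smul_apply, smul_eq_mul]
    rw [abs_le]
    constructor <;> linarith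
  · have i1 := X.stepFun_integrableOn (X.averageSum_mem hq x)
    have i2 := X.stepFun_integrableOn (X.averageSum_mem hs x)
    have i3 := (X.stepFun_integrableOn hJ).smul c
    have h1 : X.firstCells v (m + 1) x ≤ 1 := X.firstCells_le_one hv hm x
    rw [integral_add' (i1.add i2) i3, integral_add' i1 i2, X.integral_averageSum hq,
      X.integral_averageSum hs, hs_def, coverCount_range]
    simp only [Pi.smul_apply, smul_eq_mul]
    rw [integral_const_mul, X.integral_firstCells hv hm, div_mul_cancel₀ _ hP.ne']
    linarith

/-- Induction over the vertices `t` still to be split, `q` holding what has been settled. Either `p`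
stops among the children of the first vertex, which is the sibling estimate, or that vertex is split
completely and its children (or itself, if a leaf) move to `q` without changing the cover count. -/
lemma isDominated_prefix {t : List (List ℕ)} (ht : ∀ v ∈ t, X.IsVertex v) {q : List (List ℕ)}
    (hq : ∀ a ∈ q, X.IsVertex a) {x : ℝ} (hx : X.coverCount (q ++ t) x ≤ 1)
    {p : List (List ℕ)} (hp : p <+: t.flatMap X.lloChildren) :
    X.IsDominated fun y => X.averageSum (q ++ t) x y + X.kernelSum p x y := by
  have ha : ∀ {q t : List (List ℕ)}, (∀ a ∈ q, X.IsVertex a) → (∀ a ∈ t, X.IsVertex a) →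
      ∀ a ∈ q ++ t, X.IsVertex a := fun hq ht a ha =>
    (List.mem_append.1 ha).elim (hq a) (ht a)
  induction t generalizing q p with
  | nil =>
    rw [List.flatMap_nil, List.prefix_nil] at hp
    simpa [hp, kernelSum] using X.isDominated_averageSum (ha hq ht) hx
  | cons v t ih =>
    have hv := ht v (by simp)
    have ht' : ∀ b ∈ t, X.IsVertex b := fun b hb => ht b (by simp [hb])
    rw [List.flatMap_cons] at hp
    rcases List.prefix_or_prefix_of_prefix hp (List.prefix_append _ _) with h | ⟨p', rfl⟩
    · rw [List.prefix_iff_eq_take, lloChildren, ← List.map_take, List.take_range] at h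
      rw [h]
      by_cases h0 : X.arity v = 0
      · simpa [h0, kernelSum] using X.isDominated_averageSum (ha hq ht) hx
      · exact X.isDominated_siblings (ha hq ht) hx hv (by omega)
    · rw [List.prefix_append_right_inj] at hp
      have hc : ∀ a ∈ X.leaves [v] ++ X.children v, X.IsVertex a := by
        refine ha (fun a h => ?_) fun a h => ?_
        · rw [List.mem_singleton.1 (List.mem_filter.1 h).1]; exact hv
        · obtain ⟨i, hi, rfl⟩ := List.mem_map.1 h
          exact ⟨List.mem_range.1 hi, hv⟩
      have h1 := X.coverCount_children hv x
      have h2 := fun y => X.kernelSum_lloChildren hv x y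
      rw [← List.singleton_append (l := t), coverCount_append, coverCount_append] at hx
      have := ih ht' (ha hq hc) (by
        rw [coverCount_append, coverCount_append, h1]; linarith) hp
      convert this using 2 with y
      rw [← List.singleton_append (l := t), averageSum_append, averageSum_append, averageSum_append,
        averageSum_append, kernelSum_append]
      linarith [h2 y]

/-- Complete generations give the averaging kernel of the cells at level `L` together with the
leaves met earlier, which are collected in `q`. -/
lemma kernelSum_lloPrefix (L : ℕ) : ∃ q : List (List ℕ), (∀ a ∈ q, X.IsVertex a) ∧
    (∀ x, X.coverCount (q ++ X.level L) x ≤ 1) ∧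
    ∀ x y, X.kernelSum (X.lloPrefix L) x y = X.averageSum (q ++ X.level L) x y := by
  induction L with
  | zero =>
    refine ⟨[], by simp, fun x => ?_, fun x y => ?_⟩
    · simp only [List.nil_append, level, coverCount, List.map_cons, List.map_nil, List.sum_cons,
        List.sum_nil, add_zero]
      exact Set.indicator_le_self' (fun _ _ => zero_le_one) x
    · simp [level, lloPrefix, lloLevel, kernelSum, averageSum, polyAt, normSqAt, X.w_root]
  | succ L ih =>
    obtain ⟨q, hq, hm, hk⟩ := ih
    refine ⟨q ++ X.leaves (X.level L), fun a ha => ?_, fun x => ?_, fun x y => ?_⟩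
    · rcases List.mem_append.1 ha with h | h
      · exact hq a h
      · exact X.level_isVertex (List.mem_filter.1 h).1
    · have := X.coverCount_generation (fun v hv => X.level_isVertex (L := L) hv) x
      have := hm x
      rw [coverCount_append] at this
      rw [level_succ, coverCount_append, coverCount_append]
      linarith
    · have := X.kernelSum_generation (fun v hv => X.level_isVertex (L := L) hv) x y
      rw [lloPrefix_succ, kernelSum_append, hk, lloLevel_succ, level_succ, averageSum_append,
        averageSum_append, averageSum_append]
      linarith

lemma isDominated_kernelSum {L : ℕ} {p : List (List ℕ)} (hp : p <+: X.lloPrefix L) (x : ℝ) :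
    X.IsDominated (X.kernelSum p x) := by
  induction L with
  | zero =>
    have : p <+: [[]] := hp
    obtain ⟨q, hq, hm, hk⟩ := X.kernelSum_lloPrefix 0
    rw [List.prefix_cons_iff] at this
    rcases this with rfl | ⟨p', rfl, h⟩
    · refine ⟨0, Submodule.zero_mem _, ?_, ?_⟩ <;> simp [kernelSum]
    · rw [List.prefix_nil.1 h, show [[]] = X.lloPrefix 0 from rfl, show X.kernelSum _ x = _ from
        funext (hk x)]
      refine X.isDominated_averageSum (fun a ha => ?_) (hm x)
      exact (List.mem_append.1 ha).elim (hq a) X.level_isVertex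
  | succ L ih =>
    rw [lloPrefix_succ] at hp
    rcases List.prefix_or_prefix_of_prefix hp (List.prefix_append _ _) with h | ⟨p', rfl⟩
    · exact ih h
    · rw [List.prefix_append_right_inj, lloLevel_succ] at hp
      obtain ⟨q, hq, hm, hk⟩ := X.kernelSum_lloPrefix L
      convert X.isDominated_prefix (fun v hv => X.level_isVertex hv) hq (hm x) hp using 1
      ext y
      rw [kernelSum_append, hk]

end Filtration

/-! ### The leave-left-out enumeration -/

namespace Filtration

variable (X : Filtration)

open TreeData

lemma length_of_mem_level {L : ℕ} {v : List ℕ} (h : v ∈ X.level L) : v.length = L := by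
  induction L generalizing v with
  | zero => rw [List.mem_singleton.1 h]; rfl
  | succ L ih =>
    rw [level_succ, List.mem_flatMap] at h
    obtain ⟨u, hu, h⟩ := h
    obtain ⟨i, hi, rfl⟩ := List.mem_map.1 h
    rw [List.length_cons, ih hu]

lemma mem_level_length {v : List ℕ} (hv : X.IsVertex v) : v ∈ X.level v.length := by
  induction v with
  | nil => exact List.mem_singleton.2 rfl
  | cons i v ih =>
    rw [List.length_cons, level_succ, List.mem_flatMap]
    exact ⟨v, ih hv.2, List.mem_map.2 ⟨i, List.mem_range.2 hv.1, rfl⟩⟩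

/-- An empty level would make all later ones empty, leaving only finitely many vertices. -/
lemma level_ne_nil (L : ℕ) : X.level L ≠ [] := by
  intro h
  have hL : ∀ n, X.level (L + n) = [] := by
    intro n
    induction n with
    | zero => exact h
    | succ n ih => rw [← add_assoc, level_succ, ih, List.flatMap_nil]
  refine X.infinite (((Finset.range L).finite_toSet.biUnion fun n _ =>
    (X.level n).finite_toSet).subset fun v hv => ?_)
  have hv' := X.mem_level_length hv
  simp only [Set.mem_iUnion]
  refine ⟨v.length, ?_, hv'⟩
  by_contra hlt
  obtain ⟨n, hn⟩ := Nat.exists_eq_add_of_le (not_lt.1 fun h => hlt (by simpa using h))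
  rw [hn, hL n] at hv'
  simp at hv'

/-- A vertex at level `L + 1` has a parent with at least two children, and the child with index `1`
is not left-most. -/
lemma lloLevel_ne_nil (L : ℕ) : X.lloLevel L ≠ [] := by
  cases L with
  | zero => simp [lloLevel]
  | succ L =>
    obtain ⟨u, hu⟩ := List.exists_mem_of_ne_nil _ (X.level_ne_nil (L + 1))
    rw [level_succ, List.mem_flatMap] at hu
    obtain ⟨v, hv, h⟩ := hu
    obtain ⟨i, hi, rfl⟩ := List.mem_map.1 h
    have h2 := X.two_le_arity v (X.level_isVertex hv) (Nat.zero_lt_of_lt (List.mem_range.1 hi)).ne'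
    rw [lloLevel_succ]
    refine List.ne_nil_of_mem (List.mem_flatMap.2 ⟨v, hv, List.mem_map.2 ⟨0, ?_, rfl⟩⟩)
    rw [List.mem_range]; omega

lemma lt_length_lloPrefix (n : ℕ) : n < (X.lloPrefix n).length := by
  induction n with
  | zero => simp [lloPrefix, lloLevel]
  | succ n ih =>
    rw [lloPrefix_succ, List.length_append]
    have := List.length_pos_iff.2 (X.lloLevel_ne_nil (n + 1))
    omega

lemma lloPrefix_prefix {n m : ℕ} (h : n ≤ m) : X.lloPrefix n <+: X.lloPrefix m := by
  induction h with
  | refl => exact List.prefix_rfl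
  | step _ ih => exact ih.trans (by rw [lloPrefix_succ]; exact List.prefix_append _ _)

/-- The number of a vertex does not depend on how many levels are listed, and the default of `getD`
is never used. -/
lemma lloVertex_eq {n m : ℕ} (h : n ≤ m) :
    ∃ hn : n < (X.lloPrefix m).length, X.lloVertex n = (X.lloPrefix m)[n] := by
  have hn := X.lt_length_lloPrefix n
  have hp := X.lloPrefix_prefix h
  refine ⟨hn.trans_le hp.length_le, ?_⟩
  rw [lloVertex, List.getD_eq_getElem _ _ hn]
  exact hp.getElem hn

lemma isLlo_of_mem_lloLevel {L : ℕ} {a : List ℕ} (h : a ∈ X.lloLevel L) : X.IsLlo a := by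
  cases L with
  | zero => rw [List.mem_singleton.1 h]; exact ⟨trivial, by simp⟩
  | succ L =>
    have := List.mem_filter.1 h
    exact ⟨X.level_isVertex this.1, by simpa using this.2⟩

lemma isLlo_lloVertex (n : ℕ) : X.IsLlo (X.lloVertex n) := by
  obtain ⟨hn, h⟩ := X.lloVertex_eq (le_refl n)
  have := List.getElem_mem hn
  rw [← h, lloPrefix, List.mem_flatMap] at this
  obtain ⟨L, -, hL⟩ := this
  exact X.isLlo_of_mem_lloLevel hL

lemma lloLevel_sublist (L : ℕ) : (X.lloLevel L).Sublist (X.level L) := by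
  cases L with
  | zero => exact List.Sublist.refl _
  | succ L => exact List.filter_sublist

lemma nodup_level (L : ℕ) : (X.level L).Nodup := by
  induction L with
  | zero => simp [level]
  | succ L ih =>
    rw [level_succ, List.nodup_flatMap]
    refine ⟨fun v _ => (List.nodup_range).map fun i j h => (List.cons.inj h).1, ?_⟩
    refine ih.imp fun {u v} huv a ha hb => ?_
    obtain ⟨i, -, rfl⟩ := List.mem_map.1 ha
    obtain ⟨j, -, h⟩ := List.mem_map.1 hb
    exact huv (List.cons.inj h).2.symm

lemma nodup_lloPrefix (L : ℕ) : (X.lloPrefix L).Nodup := by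
  rw [lloPrefix, List.nodup_flatMap]
  refine ⟨fun n _ => (X.lloLevel_sublist n).nodup (X.nodup_level n), ?_⟩
  refine List.nodup_range.imp fun {m n} hmn a ha hb => hmn ?_
  rw [← X.length_of_mem_level ((X.lloLevel_sublist m).subset ha),
    X.length_of_mem_level ((X.lloLevel_sublist n).subset hb)]

lemma lloVertex_injective : Function.Injective X.lloVertex := by
  intro m n h
  obtain ⟨hm, hm'⟩ := X.lloVertex_eq (le_max_left m n)
  obtain ⟨hn, hn'⟩ := X.lloVertex_eq (le_max_right m n)
  rw [hm', hn'] at h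
  exact (X.nodup_lloPrefix _).getElem_inj_iff.1 h

lemma map_lloVertex_prefix (N : ℕ) :
    (List.range (N + 1)).map X.lloVertex <+: X.lloPrefix N := by
  rw [List.prefix_iff_getElem]
  refine ⟨by simpa using X.lt_length_lloPrefix N, fun i hi => ?_⟩
  simp only [List.length_map, List.length_range] at hi
  obtain ⟨h, h'⟩ := X.lloVertex_eq (Nat.le_of_lt_succ hi)
  simpa using h'

/-! ### Normalized tree polynomials -/

/-- The normalized tree polynomials, cut off outside `[0,1)`. -/
def psiCut (n : ℕ) (x : ℝ) : ℝ :=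
  X.polyAt (X.lloVertex n) x / Real.sqrt (X.normSqAt (X.lloVertex n))

/-- The two differ outside `[0,1)`, where `psi 0` is still `1`; only points of `[0,1)` matter, as
`G` lies in the unit square. -/
lemma psi_eq_polyAt (n : ℕ) {x : ℝ} (hx : x ∈ Set.Ico (0 : ℝ) 1) :
    X.psi n x = X.polyAt (X.lloVertex n) x := by
  rw [TreeData.psi]
  split
  · next h => rw [h, polyAt, cell_of_mem _ (X.interval_root ▸ hx)]
  · next l v h => rw [h, polyAt]

lemma psiN_eq_psiCut (n : ℕ) {x : ℝ} (hx : x ∈ Set.Ico (0 : ℝ) 1) :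
    X.psiN n x = X.psiCut n x := by
  rw [psiN, psiCut, X.psi_eq_polyAt n hx, ← X.integral_polyAt_sq (X.isLlo_lloVertex n)]
  congr 2
  refine setIntegral_congr_fun measurableSet_Ico fun t ht => ?_
  simp only [X.psi_eq_polyAt n ht, sq]

lemma psiCut_mem (n : ℕ) : X.psiCut n ∈ X.stepFun := by
  have : X.psiCut n = (Real.sqrt (X.normSqAt (X.lloVertex n)))⁻¹ • X.polyAt (X.lloVertex n) := by
    ext x; simp [psiCut]; ring
  rw [this]
  exact Submodule.smul_mem _ _ (X.polyAt_mem (X.isLlo_lloVertex n))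

lemma integral_psiCut_mul (m n : ℕ) :
    ∫ x in Set.Ico (0 : ℝ) 1, X.psiCut m x * X.psiCut n x = if m = n then 1 else 0 := by
  simp only [psiCut, div_mul_div_comm]
  rw [integral_div]
  split_ifs with h
  · have := X.normSqAt_pos (X.isLlo_lloVertex n)
    rw [h, X.integral_polyAt_sq (X.isLlo_lloVertex n), Real.mul_self_sqrt this.le,
      div_self this.ne']
  · rw [X.integral_polyAt_mul (X.isLlo_lloVertex m) (X.isLlo_lloVertex n)
      fun h' => h (X.lloVertex_injective h'), zero_div]

/-- The kernel of the partial sums of the expansion in tree polynomials. -/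
def kernel (N : ℕ) (x y : ℝ) : ℝ := ∑ n ∈ Finset.range (N + 1), X.psiCut n x * X.psiCut n y

lemma isDominated_kernel (N : ℕ) (x : ℝ) : X.IsDominated (X.kernel N x) := by
  have : X.kernel N x = X.kernelSum ((List.range (N + 1)).map X.lloVertex) x := by
    ext y
    rw [kernel, kernelSum, List.map_map, ← List.sum_toFinset _ List.nodup_range,
      List.toFinset_range]
    refine Finset.sum_congr rfl fun n _ => ?_
    rw [psiCut, psiCut, div_mul_div_comm,
      Real.mul_self_sqrt (X.normSqAt_pos (X.isLlo_lloVertex n)).le]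
    rfl
  rw [this]
  exact X.isDominated_kernelSum (X.map_lloVertex_prefix N) x

end Filtration

/-! ### Product formula for the measure on the digraph -/

namespace DigraphRep

variable (D : DigraphRep)

open TreeData

instance isProbabilityMeasure_ν : IsProbabilityMeasure D.ν := D.prob

lemma fst_mem (x : D.G) : x.1.1 ∈ Set.Ico (0 : ℝ) 1 := (D.G_subset x.2).1

lemma snd_mem (x : D.G) : x.1.2 ∈ Set.Ico (0 : ℝ) 1 := (D.G_subset x.2).2

/-- The nodes of the digraph in a rectangle. -/
def rect (u v : List ℕ) : Set D.G :=
  {x | (x : ℝ × ℝ) ∈ D.X₁.interval u ×ˢ D.X₂.interval v}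

lemma measurableSet_rect (u v : List ℕ) : MeasurableSet (D.rect u v) :=
  (measurableSet_Ico.prod measurableSet_Ico).preimage measurable_subtype_coe

lemma cell_mul_cell_eq (u v : List ℕ) :
    (fun x : D.G => D.X₁.cell u x.1.1 * D.X₂.cell v x.1.2) = (D.rect u v).indicator 1 := by
  ext x
  by_cases h1 : x.1.1 ∈ D.X₁.interval u <;> by_cases h2 : x.1.2 ∈ D.X₂.interval v <;>
    simp [cell, rect, h1, h2, Set.indicator]

lemma integral_cell_mul_cell (u v : List ℕ) :
    ∫ x, D.X₁.cell u x.1.1 * D.X₂.cell v x.1.2 ∂D.ν = D.ν.real (D.rect u v) := by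
  rw [D.cell_mul_cell_eq, integral_indicator_one (D.measurableSet_rect u v)]

lemma integrable_cell_mul_cell (u v : List ℕ) :
    Integrable (fun x : D.G => D.X₁.cell u x.1.1 * D.X₂.cell v x.1.2) D.ν := by
  rw [D.cell_mul_cell_eq]
  exact (integrable_const (1 : ℝ)).indicator (D.measurableSet_rect u v)

/-- A rectangle that misses `G` has measure zero, so the inequality survives where the weight
condition says nothing. -/
lemma real_rect_le {u v : List ℕ} (hu : D.X₁.IsVertex u) (hv : D.X₂.IsVertex v) :
    D.ν.real (D.rect u v) ≤ D.X₁.w u * D.X₂.w v := by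
  have h0 : 0 ≤ D.X₁.w u * D.X₂.w v := (mul_pos (D.X₁.w_pos u hu) (D.X₂.w_pos v hv)).le
  by_cases h : (D.G ∩ D.X₁.interval u ×ˢ D.X₂.interval v).Nonempty
  · have := D.weight u v hu hv h
    rw [Measure.real, rect, this, ENNReal.toReal_ofReal h0]
  · have : D.rect u v = ∅ := by
      rw [Set.eq_empty_iff_forall_notMem]
      exact fun x hx => h ⟨x, x.2, hx⟩
    simpa [this] using h0

lemma real_rect_root : D.ν.real (D.rect [] []) = 1 := by
  have : D.rect [] [] = Set.univ := by
    rw [Set.eq_univ_iff_forall]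
    intro x
    exact ⟨D.X₁.interval_root ▸ D.fst_mem x, D.X₂.interval_root ▸ D.snd_mem x⟩
  rw [this, probReal_univ]

/-- Both sides are additive over the children of `u` and agree on `u`; since `≤` holds for each
child, equality of the sums forces equality for each. -/
lemma real_rect_cons_left {u v : List ℕ} {i : ℕ} (hu : D.X₁.IsVertex (i :: u))
    (hv : D.X₂.IsVertex v) (h : D.ν.real (D.rect u v) = D.X₁.w u * D.X₂.w v) :
    D.ν.real (D.rect (i :: u) v) = D.X₁.w (i :: u) * D.X₂.w v := by
  have hle : ∀ j ∈ Finset.range (D.X₁.arity u),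
      D.ν.real (D.rect (j :: u) v) ≤ D.X₁.w (j :: u) * D.X₂.w v := fun j hj =>
    D.real_rect_le (u := j :: u) ⟨Finset.mem_range.1 hj, hu.2⟩ hv
  refine (Finset.sum_eq_sum_iff_of_le hle).1 ?_ i (Finset.mem_range.2 hu.1)
  have h0 := D.X₁.arity_ne_zero hu
  rw [← Finset.sum_mul, D.X₁.w_children u hu.2 h0, ← h, ← integral_cell_mul_cell]
  simp_rw [← D.integral_cell_mul_cell, ← D.X₁.sum_children_cell hu.2 h0, firstCells,
    Finset.sum_mul]
  rw [integral_finsetSum _ fun j _ => D.integrable_cell_mul_cell _ _]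

lemma real_rect_cons_right {u v : List ℕ} {i : ℕ} (hu : D.X₁.IsVertex u)
    (hv : D.X₂.IsVertex (i :: v)) (h : D.ν.real (D.rect u v) = D.X₁.w u * D.X₂.w v) :
    D.ν.real (D.rect u (i :: v)) = D.X₁.w u * D.X₂.w (i :: v) := by
  have hle : ∀ j ∈ Finset.range (D.X₂.arity v),
      D.ν.real (D.rect u (j :: v)) ≤ D.X₁.w u * D.X₂.w (j :: v) := fun j hj =>
    D.real_rect_le (v := j :: v) hu ⟨Finset.mem_range.1 hj, hv.2⟩
  refine (Finset.sum_eq_sum_iff_of_le hle).1 ?_ i (Finset.mem_range.2 hv.1)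
  have h0 := D.X₂.arity_ne_zero hv
  rw [← Finset.mul_sum, D.X₂.w_children v hv.2 h0, ← h, ← integral_cell_mul_cell]
  simp_rw [← D.integral_cell_mul_cell, ← D.X₂.sum_children_cell hv.2 h0, firstCells,
    Finset.mul_sum]
  rw [integral_finsetSum _ fun j _ => D.integrable_cell_mul_cell _ _]

/-- Every rectangle has the weight of a product measure; in particular, all of them meet `G`. -/
lemma real_rect {u v : List ℕ} (hu : D.X₁.IsVertex u) (hv : D.X₂.IsVertex v) :
    D.ν.real (D.rect u v) = D.X₁.w u * D.X₂.w v := by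
  induction u with
  | nil =>
    induction v with
    | nil => rw [D.real_rect_root, D.X₁.w_root, D.X₂.w_root, one_mul]
    | cons i v ih => exact D.real_rect_cons_right hu hv (ih hv.2)
  | cons i u ih => exact D.real_rect_cons_left hu hv (ih hu.2)

lemma integrable_and_integral_stepFun {F H : ℝ → ℝ} (hF : F ∈ D.X₁.stepFun)
    (hH : H ∈ D.X₂.stepFun) :
    Integrable (fun x : D.G => F x.1.1 * H x.1.2) D.ν ∧
    ∫ x, F x.1.1 * H x.1.2 ∂D.ν =
      (∫ t in Set.Ico (0 : ℝ) 1, F t) * ∫ t in Set.Ico (0 : ℝ) 1, H t := by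
  induction hF, hH using Submodule.span_induction₂ with
  | mem_mem x y hx hy =>
    obtain ⟨u, hu, rfl⟩ := hx
    obtain ⟨v, hv, rfl⟩ := hy
    refine ⟨D.integrable_cell_mul_cell u v, ?_⟩
    rw [D.integral_cell_mul_cell, D.real_rect hu hv, D.X₁.integral_cell hu, D.X₂.integral_cell hv]
  | zero_left y hy => simp
  | zero_right x hx => simp
  | add_left x y z hx hy _ h1 h2 =>
    simp only [Pi.add_apply, add_mul]
    refine ⟨h1.1.add h2.1, ?_⟩
    rw [integral_add h1.1 h2.1, h1.2, h2.2, integral_add (D.X₁.stepFun_integrableOn hx)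
      (D.X₁.stepFun_integrableOn hy), add_mul]
  | add_right x y z _ hy hz h1 h2 =>
    simp only [Pi.add_apply, mul_add]
    refine ⟨h1.1.add h2.1, ?_⟩
    rw [integral_add h1.1 h2.1, h1.2, h2.2, integral_add (D.X₂.stepFun_integrableOn hy)
      (D.X₂.stepFun_integrableOn hz), mul_add]
  | smul_left r x y _ _ h =>
    simp only [Pi.smul_apply, smul_eq_mul, mul_assoc]
    refine ⟨h.1.const_mul r, ?_⟩
    rw [integral_const_mul, integral_const_mul, h.2, mul_assoc]
  | smul_right r x y _ _ h =>
    simp only [Pi.smul_apply, smul_eq_mul, mul_left_comm _ r]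
    refine ⟨h.1.const_mul r, ?_⟩
    rw [integral_const_mul, integral_const_mul, h.2]
    ring

lemma psi_apply (k : ℕ × ℕ) (x : D.G) :
    D.psi k x = D.X₁.psiCut k.1 x.1.1 * D.X₂.psiCut k.2 x.1.2 := by
  rw [DigraphRep.psi, D.X₁.psiN_eq_psiCut _ (D.fst_mem x), D.X₂.psiN_eq_psiCut _ (D.snd_mem x)]

/-- The tensor product tree polynomials are orthonormal. -/
lemma coeff_psi (k l : ℕ × ℕ) : D.coeff (D.psi k) l = if k = l then 1 else 0 := by
  have := (D.integrable_and_integral_stepFun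
    (D.X₁.mul_mem_stepFun (D.X₁.psiCut_mem k.1) (D.X₁.psiCut_mem l.1))
    (D.X₂.mul_mem_stepFun (D.X₂.psiCut_mem k.2) (D.X₂.psiCut_mem l.2))).2
  simp only [Pi.mul_apply, Filtration.integral_psiCut_mul] at this
  rw [coeff]
  simp only [psi_apply]
  simp only [mul_mul_mul_comm]
  rw [this]
  by_cases h1 : k.1 = l.1 <;> by_cases h2 : k.2 = l.2 <;> simp [Prod.ext_iff, h1, h2]

lemma Omega_eq_univ : D.Omega = Set.univ := by
  rw [Set.eq_univ_iff_forall]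
  intro k hk
  have h := D.coeff_psi k k
  rw [if_pos rfl, hk] at h
  simp [coeff] at h

lemma measurable_psi (k : ℕ × ℕ) : Measurable (D.psi k) := by
  have h1 := D.X₁.stepFun_measurable (D.X₁.psiCut_mem k.1)
  have h2 := D.X₂.stepFun_measurable (D.X₂.psiCut_mem k.2)
  rw [funext (D.psi_apply k)]
  exact (h1.comp (measurable_fst.comp measurable_subtype_coe)).mul
    (h2.comp (measurable_snd.comp measurable_subtype_coe))

lemma integrable_psi (k : ℕ × ℕ) : Integrable (D.psi k) D.ν := by
  rw [funext (D.psi_apply k)]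
  exact (D.integrable_and_integral_stepFun (D.X₁.psiCut_mem k.1) (D.X₂.psiCut_mem k.2)).1

lemma lintegral_kernel_le (a b : ℕ) (x₁ x₂ : ℝ) :
    ∫⁻ y, ‖D.X₁.kernel a x₁ y.1.1 * D.X₂.kernel b x₂ y.1.2‖ₑ ∂D.ν ≤ 9 := by
  obtain ⟨M, hM, hM', hM3⟩ := D.X₁.isDominated_kernel a x₁
  obtain ⟨N, hN, hN', hN3⟩ := D.X₂.isDominated_kernel b x₂
  have hM0 : ∀ t, 0 ≤ M t := fun t => (abs_nonneg _).trans (hM' t)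
  have hN0 : ∀ t, 0 ≤ N t := fun t => (abs_nonneg _).trans (hN' t)
  obtain ⟨hi, hI⟩ := D.integrable_and_integral_stepFun hM hN
  calc ∫⁻ y, ‖D.X₁.kernel a x₁ y.1.1 * D.X₂.kernel b x₂ y.1.2‖ₑ ∂D.ν
      ≤ ∫⁻ y, ENNReal.ofReal (M y.1.1 * N y.1.2) ∂D.ν := by
        refine lintegral_mono fun y => ?_
        rw [Real.enorm_eq_ofReal_abs, abs_mul]
        exact ENNReal.ofReal_le_ofReal
          (mul_le_mul (hM' _) (hN' _) (abs_nonneg _) (hM0 _))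
    _ = ENNReal.ofReal (∫ y, M y.1.1 * N y.1.2 ∂D.ν) :=
        (ofReal_integral_eq_lintegral_ofReal hi
          (Filter.Eventually.of_forall fun y => mul_nonneg (hM0 _) (hN0 _))).symm
    _ ≤ ENNReal.ofReal 9 := by
        rw [hI]
        refine ENNReal.ofReal_le_ofReal ?_
        have : (0 : ℝ) ≤ ∫ t in Set.Ico (0 : ℝ) 1, N t := integral_nonneg hN0
        nlinarith
    _ = 9 := by simp

end DigraphRep

/-! ### The uniform norm -/

section SupNorm

variable {α : Type*}

lemma enorm_le_supNorm (f : α → ℝ) (x : α) : ‖f x‖ₑ ≤ supNorm f := le_iSup (fun x => ‖f x‖ₑ) x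

lemma supNorm_zero : supNorm (0 : α → ℝ) = 0 := by simp [supNorm]

lemma supNorm_add_le (f g : α → ℝ) : supNorm (f + g) ≤ supNorm f + supNorm g :=
  iSup_le fun x => (enorm_add_le _ _).trans
    (add_le_add (enorm_le_supNorm f x) (enorm_le_supNorm g x))

lemma supNorm_neg (f : α → ℝ) : supNorm (-f) = supNorm f := by simp [supNorm]

lemma supNorm_sub_le (f g : α → ℝ) : supNorm (f - g) ≤ supNorm f + supNorm g := by
  rw [sub_eq_add_neg, ← supNorm_neg g]; exact supNorm_add_le _ _

lemma supNorm_smul (c : ℝ) (f : α → ℝ) : supNorm (c • f) = ‖c‖ₑ * supNorm f := by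
  simp [supNorm, ENNReal.mul_iSup]

lemma supNorm_sum_le {ι : Type*} (s : Finset ι) (f : ι → α → ℝ) :
    supNorm (∑ i ∈ s, f i) ≤ ∑ i ∈ s, supNorm (f i) := by
  classical
  induction s using Finset.induction_on with
  | empty => simp [supNorm_zero]
  | insert a s ha ih =>
    rw [Finset.sum_insert ha, Finset.sum_insert ha]
    exact (supNorm_add_le _ _).trans (by gcongr)

end SupNorm

lemma Filtration.stepFun_bounded (X : Filtration) {F : ℝ → ℝ} (hF : F ∈ X.stepFun) :
    supNorm F < ∞ := by
  induction hF using Submodule.span_induction with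
  | mem x hx =>
    obtain ⟨v, -, rfl⟩ := hx
    refine lt_of_le_of_lt (iSup_le fun t => ?_) (ENNReal.one_lt_top)
    by_cases h : t ∈ X.interval v <;> simp [TreeData.cell, h]
  | zero => simp [supNorm_zero]
  | add x y _ _ h1 h2 => exact (supNorm_add_le x y).trans_lt (ENNReal.add_lt_top.2 ⟨h1, h2⟩)
  | smul c x _ h => rw [supNorm_smul]; exact ENNReal.mul_lt_top enorm_lt_top h

namespace DigraphRep

variable (D : DigraphRep)

/-! ### The space of uniform limits of tree polynomials -/

lemma supNorm_psi_lt_top (k : ℕ × ℕ) : supNorm (D.psi k) < ∞ := by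
  refine lt_of_le_of_lt (iSup_le fun x => ?_) (ENNReal.mul_lt_top
    (D.X₁.stepFun_bounded (D.X₁.psiCut_mem k.1)) (D.X₂.stepFun_bounded (D.X₂.psiCut_mem k.2)))
  rw [psi_apply, enorm_mul]
  exact mul_le_mul' (enorm_le_supNorm _ _) (enorm_le_supNorm _ _)

lemma psi_mem_span (k : ℕ × ℕ) : D.psi k ∈ Submodule.span ℝ (D.psi '' D.Omega) :=
  Submodule.subset_span ⟨k, by simp [D.Omega_eq_univ], rfl⟩

lemma mem_F_of_mem_span {P : D.G → ℝ} (hP : P ∈ Submodule.span ℝ (D.psi '' D.Omega)) :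
    P ∈ D.F := fun ε _ => ⟨P, hP, by simp [supNorm_zero]⟩

lemma sub_mem_F {f h : D.G → ℝ} (hf : f ∈ D.F) (hh : h ∈ D.F) : f - h ∈ D.F := by
  intro ε hε
  have h2 : ε / 2 > 0 := ENNReal.half_pos hε.ne'
  obtain ⟨P, hP, hP'⟩ := hf _ h2
  obtain ⟨Q, hQ, hQ'⟩ := hh _ h2
  refine ⟨P - Q, Submodule.sub_mem _ hP hQ, ?_⟩
  rw [sub_sub_sub_comm]
  exact (supNorm_sub_le _ _).trans ((add_le_add hP' hQ').trans (ENNReal.add_halves ε).le)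

lemma span_bounded {P : D.G → ℝ} (hP : P ∈ Submodule.span ℝ (D.psi '' D.Omega)) :
    supNorm P < ∞ ∧ Measurable P := by
  induction hP using Submodule.span_induction with
  | mem x hx =>
    obtain ⟨k, -, rfl⟩ := hx
    exact ⟨D.supNorm_psi_lt_top k, D.measurable_psi k⟩
  | zero => exact ⟨by simp [supNorm_zero], measurable_const⟩
  | add x y _ _ h1 h2 =>
    exact ⟨(supNorm_add_le x y).trans_lt (ENNReal.add_lt_top.2 ⟨h1.1, h2.1⟩), h1.2.add h2.2⟩
  | smul c x _ h =>
    exact ⟨by rw [supNorm_smul]; exact ENNReal.mul_lt_top enorm_lt_top h.1, h.2.const_smul c⟩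

lemma supNorm_lt_top {f : D.G → ℝ} (hf : f ∈ D.F) : supNorm f < ∞ := by
  obtain ⟨P, hP, h⟩ := hf 1 one_pos
  rw [← sub_add_cancel f P]
  exact (supNorm_add_le _ _).trans_lt
    (ENNReal.add_lt_top.2 ⟨h.trans_lt ENNReal.one_lt_top, (D.span_bounded hP).1⟩)

/-- Measurability passes to uniform limits. With boundedness it makes the coefficients genuine
integrals, hence linear in `f` on `𝓕`. -/
lemma measurable_of_mem_F {f : D.G → ℝ} (hf : f ∈ D.F) : Measurable f := by
  have hε : ∀ n : ℕ, ((n : ℝ≥0∞) + 1)⁻¹ > 0 := fun n =>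
    ENNReal.inv_pos.2 (by finiteness)
  choose P hP hP' using fun n : ℕ => hf _ (hε n)
  refine measurable_of_tendsto_metrizable (fun n => (D.span_bounded (hP n)).2)
    (tendsto_pi_nhds.2 fun x => ?_)
  rw [tendsto_iff_edist_tendsto_0]
  have h0 : Filter.Tendsto (fun n : ℕ => ((n : ℝ≥0∞) + 1)⁻¹) Filter.atTop (nhds 0) := by
    have := (Filter.tendsto_add_atTop_iff_nat 1).2 ENNReal.tendsto_inv_nat_nhds_zero
    simpa using this
  refine tendsto_of_tendsto_of_tendsto_of_le_of_le tendsto_const_nhds h0 (fun _ => zero_le) ?_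
  intro n
  beta_reduce
  rw [edist_comm]
  simp only [edist_eq_enorm_sub]
  exact (enorm_le_supNorm (f - P n) x).trans (hP' n)

lemma integrable_mul_psi {f : D.G → ℝ} (hf : f ∈ D.F) (k : ℕ × ℕ) :
    Integrable (fun x => f x * D.psi k x) D.ν := by
  refine (D.integrable_psi k).bdd_mul (c := (supNorm f).toReal)
    (D.measurable_of_mem_F hf).aestronglyMeasurable (Filter.Eventually.of_forall fun x => ?_)
  rw [← toReal_enorm]
  exact ENNReal.toReal_mono (D.supNorm_lt_top hf).ne (enorm_le_supNorm f x)

lemma psi_mem_F (k : ℕ × ℕ) : D.psi k ∈ D.F := D.mem_F_of_mem_span (D.psi_mem_span k)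

lemma coeff_sum (s : Finset (ℕ × ℕ)) (c : ℕ × ℕ → ℝ) (l : ℕ × ℕ) :
    D.coeff (∑ k ∈ s, c k • D.psi k) l = if l ∈ s then c l else 0 := by
  have h : ∀ x, (∑ k ∈ s, c k • D.psi k) x * D.psi l x =
      ∑ k ∈ s, c k * (D.psi k x * D.psi l x) := by
    intro x
    simp only [Finset.sum_apply, Pi.smul_apply, smul_eq_mul, Finset.sum_mul, mul_assoc]
  rw [coeff]
  simp only [h]
  rw [integral_finsetSum _ fun k _ => (D.integrable_mul_psi (D.psi_mem_F k) l).const_mul _]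
  simp only [integral_const_mul]
  have : ∀ k, ∫ x, D.psi k x * D.psi l x ∂D.ν = if k = l then 1 else 0 := fun k => D.coeff_psi k l
  simp [this]

lemma coeff_sub {f h : D.G → ℝ} (hf : f ∈ D.F) (hh : h ∈ D.F) (k : ℕ × ℕ) :
    D.coeff (f - h) k = D.coeff f k - D.coeff h k := by
  simp only [coeff, Pi.sub_apply, sub_mul]
  exact integral_sub (D.integrable_mul_psi hf k) (D.integrable_mul_psi hh k)

/-- The rectangular partial sums are uniformly bounded operators. -/
lemma supNorm_rectSum_le {f : D.G → ℝ} (hf : f ∈ D.F) (a b : ℕ) :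
    supNorm (∑ k ∈ Finset.range (a + 1) ×ˢ Finset.range (b + 1), D.coeff f k • D.psi k) ≤
      9 * supNorm f := by
  refine iSup_le fun x => ?_
  have h1 : (∑ k ∈ Finset.range (a + 1) ×ˢ Finset.range (b + 1), D.coeff f k • D.psi k) x =
      ∫ y, f y * (D.X₁.kernel a x.1.1 y.1.1 * D.X₂.kernel b x.1.2 y.1.2) ∂D.ν := by
    have h2 : ∀ y : D.G, f y * (D.X₁.kernel a x.1.1 y.1.1 * D.X₂.kernel b x.1.2 y.1.2) =
        ∑ k ∈ Finset.range (a + 1) ×ˢ Finset.range (b + 1),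
          (f y * D.psi k y) * D.psi k x := by
      intro y
      rw [Filtration.kernel, Filtration.kernel, Finset.sum_mul_sum, ← Finset.sum_product',
        Finset.mul_sum]
      refine Finset.sum_congr rfl fun k _ => ?_
      rw [psi_apply, psi_apply]
      ring
    simp only [h2]
    rw [integral_finsetSum _ fun k _ => (D.integrable_mul_psi hf k).mul_const _]
    simp only [integral_mul_const, Finset.sum_apply, Pi.smul_apply, smul_eq_mul, coeff]
  rw [h1]
  calc _ ≤ ∫⁻ y, ‖f y * (D.X₁.kernel a x.1.1 y.1.1 * D.X₂.kernel b x.1.2 y.1.2)‖ₑ ∂D.ν :=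
        enorm_integral_le_lintegral_enorm _
    _ ≤ ∫⁻ y, supNorm f * ‖D.X₁.kernel a x.1.1 y.1.1 * D.X₂.kernel b x.1.2 y.1.2‖ₑ ∂D.ν := by
        refine lintegral_mono fun y => ?_
        rw [enorm_mul]
        gcongr
        exact enorm_le_supNorm f y
    _ = supNorm f * ∫⁻ y, ‖D.X₁.kernel a x.1.1 y.1.1 * D.X₂.kernel b x.1.2 y.1.2‖ₑ ∂D.ν :=
        lintegral_const_mul' _ _ (D.supNorm_lt_top hf).ne
    _ ≤ supNorm f * 9 := by gcongr; exact D.lintegral_kernel_le a b _ _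
    _ = 9 * supNorm f := mul_comm _ _

end DigraphRep

/-! ### Summation by parts -/

lemma sum_Ico_diff (u : ℕ → ℝ) {k M : ℕ} (hk : k ≤ M) (hM : u M = 0) :
    ∑ m ∈ Finset.Ico k M, (u (m + 1) - u m) = - u k := by
  rw [Finset.sum_Ico_sub _ hk, hM, zero_sub]

/-- The discrete form of recovering a function from its mixed derivative: summing `Δ₁Δ₂h` over the
quadrant above `k` telescopes in both directions, and the two minus signs cancel. -/
lemma eq_sum_diff {h : ℕ × ℕ → ℝ} {M : ℕ} (hM : ∀ k : ℕ × ℕ, M ≤ k.1 ∨ M ≤ k.2 → h k = 0)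
    {k : ℕ × ℕ} (hk : k ∈ Finset.range M ×ˢ Finset.range M) :
    h k = ∑ m ∈ Finset.range M ×ˢ Finset.range M,
      if k.1 ≤ m.1 ∧ k.2 ≤ m.2 then diff₁ (diff₂ h) m else 0 := by
  obtain ⟨h1, h2⟩ := Finset.mem_product.1 hk
  rw [Finset.mem_range] at h1 h2
  have hf : (Finset.range M ×ˢ Finset.range M).filter (fun m => k.1 ≤ m.1 ∧ k.2 ≤ m.2) =
      Finset.Ico k.1 M ×ˢ Finset.Ico k.2 M := by
    ext m; simp; omega
  rw [← Finset.sum_filter, hf, Finset.sum_product_right]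
  have e1 : ∀ m₂, ∑ m₁ ∈ Finset.Ico k.1 M, diff₁ (diff₂ h) (m₁, m₂) = - diff₂ h (k.1, m₂) := by
    intro m₂
    refine sum_Ico_diff (fun m₁ => diff₂ h (m₁, m₂)) h1.le ?_
    simp [diff₂, hM]
  simp only [e1, Finset.sum_neg_distrib]
  have e2 : ∑ m₂ ∈ Finset.Ico k.2 M, diff₂ h (k.1, m₂) = - h (k.1, k.2) :=
    sum_Ico_diff (fun m₂ => h (k.1, m₂)) h2.le (hM _ (Or.inr le_rfl))
  rw [e2, neg_neg]

lemma exists_box {h : ℕ × ℕ → ℝ} (hh : (Function.support h).Finite) :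
    ∃ M : ℕ, ∀ k : ℕ × ℕ, M ≤ k.1 ∨ M ≤ k.2 → h k = 0 := by
  obtain ⟨B, hB⟩ := hh.bddAbove
  refine ⟨max B.1 B.2 + 1, fun k hk => ?_⟩
  by_contra h0
  have := hB (Function.mem_support.2 h0)
  have h1 : k.1 ≤ B.1 := this.1
  have h2 : k.2 ≤ B.2 := this.2
  omega

namespace DigraphRep

variable (D : DigraphRep)

/-! ### Multiplier operators -/

/-- The multiplier operator with symbol `h`. -/
def mult (h : ℕ × ℕ → ℝ) (f : D.G → ℝ) : D.G → ℝ := ∑ᶠ k, (h k * D.coeff f k) • D.psi k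

lemma mult_eq_sum {h : ℕ × ℕ → ℝ} {s : Finset (ℕ × ℕ)} (hs : ∀ k ∉ s, h k = 0)
    (f : D.G → ℝ) : D.mult h f = ∑ k ∈ s, (h k * D.coeff f k) • D.psi k := by
  refine finsum_eq_sum_of_support_subset _ fun k hk => ?_
  by_contra hks
  exact hk (by simp [hs k hks])

lemma mult_eq_sum_toFinset {h : ℕ × ℕ → ℝ} (hh : (Function.support h).Finite) (f : D.G → ℝ) :
    D.mult h f = ∑ k ∈ hh.toFinset, (h k * D.coeff f k) • D.psi k :=
  D.mult_eq_sum (by simp) f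

lemma coeff_mult {h : ℕ × ℕ → ℝ} (hh : (Function.support h).Finite) (f : D.G → ℝ) (k : ℕ × ℕ) :
    D.coeff (D.mult h f) k = h k * D.coeff f k := by
  rw [D.mult_eq_sum_toFinset hh, coeff_sum]
  by_cases hk : h k = 0 <;> simp [hk]

lemma mult_mem_span {h : ℕ × ℕ → ℝ} (hh : (Function.support h).Finite) (f : D.G → ℝ)
    {S : Set (ℕ × ℕ)} (hS : Function.support h ⊆ S) :
    D.mult h f ∈ Submodule.span ℝ (D.psi '' S) := by
  rw [D.mult_eq_sum_toFinset hh]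
  exact Submodule.sum_mem _ fun k hk => Submodule.smul_mem _ _
    (Submodule.subset_span ⟨k, hS (hh.mem_toFinset.1 hk), rfl⟩)

lemma mult_mem_F {h : ℕ × ℕ → ℝ} (hh : (Function.support h).Finite) (f : D.G → ℝ) :
    D.mult h f ∈ D.F :=
  D.mem_F_of_mem_span (D.mult_mem_span hh f (by simp [D.Omega_eq_univ]))

lemma mult_sub_symbol {h h' : ℕ × ℕ → ℝ} (hh : (Function.support h).Finite)
    (hh' : (Function.support h').Finite) (f : D.G → ℝ) :
    D.mult (fun k => h k - h' k) f = D.mult h f - D.mult h' f := by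
  have e : ∀ k ∉ hh.toFinset ∪ hh'.toFinset, h k = 0 ∧ h' k = 0 := fun k hk => by simpa using hk
  rw [D.mult_eq_sum (s := hh.toFinset ∪ hh'.toFinset) fun k hk => (e k hk).1,
    D.mult_eq_sum (s := hh.toFinset ∪ hh'.toFinset) fun k hk => (e k hk).2,
    D.mult_eq_sum (s := hh.toFinset ∪ hh'.toFinset) fun k hk => by simp [e k hk],
    ← Finset.sum_sub_distrib]
  exact Finset.sum_congr rfl fun k _ => by rw [← sub_smul, sub_mul]

lemma mult_sub {h : ℕ × ℕ → ℝ} (hh : (Function.support h).Finite) {f f' : D.G → ℝ}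
    (hf : f ∈ D.F) (hf' : f' ∈ D.F) : D.mult h (f - f') = D.mult h f - D.mult h f' := by
  rw [D.mult_eq_sum_toFinset hh, D.mult_eq_sum_toFinset hh, D.mult_eq_sum_toFinset hh,
    ← Finset.sum_sub_distrib]
  exact Finset.sum_congr rfl fun k _ => by rw [← sub_smul, D.coeff_sub hf hf', mul_sub]

lemma mult_congr {h h' : ℕ × ℕ → ℝ} {f f' : D.G → ℝ}
    (e : ∀ k, h k * D.coeff f k = h' k * D.coeff f' k) : D.mult h f = D.mult h' f' := by
  simp only [mult, e]

/-- Multiplier operators are bounded by the variation of their symbol. -/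
lemma supNorm_mult_le {h : ℕ × ℕ → ℝ} (hh : (Function.support h).Finite) {f : D.G → ℝ}
    (hf : f ∈ D.F) : supNorm (D.mult h f) ≤ 9 * variation h * supNorm f := by
  obtain ⟨M, hM⟩ := exists_box hh
  set B := Finset.range M ×ˢ Finset.range M
  have hB : ∀ k ∉ B, h k = 0 := fun k hk => hM k (by simp [B] at hk; omega)
  -- After exchanging the sums, the factor of `Δ₁Δ₂h(m)` is the rectangular partial sum up to `m`.
  -- Only the last term of the variation is used in the estimate.
  have key : D.mult h f = ∑ m ∈ B, diff₁ (diff₂ h) m •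
      ∑ k ∈ Finset.range (m.1 + 1) ×ˢ Finset.range (m.2 + 1), D.coeff f k • D.psi k := by
    rw [D.mult_eq_sum hB]
    have e1 : ∀ k ∈ B, (h k * D.coeff f k) • D.psi k = ∑ m ∈ B,
        if k.1 ≤ m.1 ∧ k.2 ≤ m.2 then diff₁ (diff₂ h) m • D.coeff f k • D.psi k else 0 := by
      intro k hk
      rw [mul_smul, eq_sum_diff hM hk, Finset.sum_smul]
      exact Finset.sum_congr rfl fun m _ => by split_ifs <;> simp
    rw [Finset.sum_congr rfl e1, Finset.sum_comm]
    refine Finset.sum_congr rfl fun m hm => ?_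
    rw [← Finset.sum_filter, Finset.smul_sum]
    refine Finset.sum_congr ?_ fun _ _ => rfl
    ext k
    simp only [B, Finset.mem_product, Finset.mem_range, Finset.mem_filter] at hm ⊢
    omega
  calc supNorm (D.mult h f) ≤ ∑ m ∈ B, ‖diff₁ (diff₂ h) m‖ₑ * (9 * supNorm f) := by
        rw [key]
        refine (supNorm_sum_le _ _).trans (Finset.sum_le_sum fun m _ => ?_)
        rw [supNorm_smul]
        gcongr
        exact D.supNorm_rectSum_le hf _ _
    _ = (∑ m ∈ B, ‖diff₁ (diff₂ h) m‖ₑ) * (9 * supNorm f) := (Finset.sum_mul _ _ _).symm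
    _ ≤ variation h * (9 * supNorm f) := by
        gcongr
        exact (ENNReal.sum_le_tsum B).trans le_add_self
    _ = 9 * variation h * supNorm f := by ring

end DigraphRep

/-! ### Weighted sequence spaces and discrete Hardy inequalities -/

/-- Membership in `ℓ^ρ`, for sequences with values in `[0,∞]`. -/
def InLp (ρ : ℝ≥0∞) (A : ℕ → ℝ≥0∞) : Prop :=
  if ρ = ∞ then ⨆ n, A n < ∞ else ∑' n, A n ^ ρ.toReal < ∞

lemma mem_seqSpace_iff {ρ : ℝ≥0∞} (hρ : 0 < ρ) (γ : ℝ) (a : ℕ → ℝ≥0∞) :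
    a ∈ seqSpace ρ γ ↔ InLp ρ fun n => (2 : ℝ≥0∞) ^ (n * γ) * a n := by
  rw [seqSpace, Set.mem_ofPred_eq, seqNorm, InLp]
  split_ifs with h
  · rfl
  · have hp : 0 < ρ.toReal := ENNReal.toReal_pos hρ.ne' h
    rw [ENNReal.rpow_lt_top_iff_of_pos (by positivity)]
    simp only [ENNReal.mul_rpow_of_nonneg _ _ hp.le, ENNReal.rpow_mul]

lemma sum_range_add_tsum (u : ℕ → ℝ≥0∞) (n : ℕ) :
    ∑ i ∈ Finset.range n, u i + ∑' i, u (i + n) = ∑' i, u i :=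
  Summable.sum_add_tsum_nat_add' ENNReal.summable

/-- The exponent is `|n - j|`, written with truncated subtraction. The terms with `j < n` and those
with `j ≥ n` are each bounded by one geometric series. -/
lemma tsum_pow_dist_le (q : ℝ≥0∞) (n : ℕ) :
    ∑' j : ℕ, q ^ ((n - j) + (j - n)) ≤ 2 * ∑' i : ℕ, q ^ i := by
  rw [← sum_range_add_tsum _ n, two_mul]
  refine add_le_add ?_ ?_
  · rw [← Finset.sum_range_reflect]
    refine le_trans ?_ ((ENNReal.sum_le_tsum (Finset.range n)).trans
      (ENNReal.tsum_comp_le_tsum_of_injective (add_left_injective 1) fun i => q ^ i))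
    refine Finset.sum_le_sum fun j hj => le_of_eq ?_
    have := Finset.mem_range.1 hj
    congr 1
    omega
  · exact ENNReal.tsum_le_tsum fun i => le_of_eq (by congr 1; omega)

lemma tsum_geometric_lt_top {q : ℝ≥0∞} (hq : q < 1) : ∑' i : ℕ, q ^ i < ∞ := by
  rw [ENNReal.tsum_geometric]
  exact ENNReal.inv_lt_top.2 (tsub_pos_of_lt hq)

/-- Convolution with a kernel that decays geometrically preserves `ℓ^ρ`. -/
lemma inLp_of_le_tsum {ρ : ℝ≥0∞} (hρ : 0 < ρ) {q C : ℝ≥0∞} (hq : q < 1) (hC : C ≠ ∞)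
    {A B : ℕ → ℝ≥0∞} (hB : InLp ρ B)
    (h : ∀ n, A n ≤ C * ∑' j : ℕ, (q * q) ^ ((n - j) + (j - n)) * B j) : InLp ρ A := by
  set S := ∑' i : ℕ, q ^ i
  have hS : S < ∞ := tsum_geometric_lt_top hq
  set d : ℕ → ℕ → ℕ := fun n j => (n - j) + (j - n)
  -- One factor `q ^ d` makes the series converge, the other stays inside a supremum. Passing to the
  -- supremum treats all `ρ > 0` alike, including `ρ < 1`, where the triangle inequality fails.
  have h1 : ∀ n, A n ≤ C * (2 * S) * ⨆ j, q ^ d n j * B j := by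
    intro n
    refine (h n).trans ?_
    rw [mul_assoc]
    gcongr
    calc ∑' j : ℕ, (q * q) ^ ((n - j) + (j - n)) * B j
        ≤ ∑' j : ℕ, q ^ d n j * ⨆ j, q ^ d n j * B j := by
          refine ENNReal.tsum_le_tsum fun j => ?_
          rw [mul_pow, mul_assoc]
          gcongr
          exact le_iSup (fun j => q ^ d n j * B j) j
      _ = (∑' j : ℕ, q ^ d n j) * ⨆ j, q ^ d n j * B j := ENNReal.tsum_mul_right
      _ ≤ 2 * S * ⨆ j, q ^ d n j * B j := by gcongr; exact tsum_pow_dist_le q n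
  have hK : C * (2 * S) < ∞ :=
    ENNReal.mul_lt_top hC.lt_top (ENNReal.mul_lt_top (by simp) hS)
  rw [InLp] at hB ⊢
  split_ifs at hB ⊢ with hρ'
  · refine lt_of_le_of_lt (iSup_le fun n => (h1 n).trans ?_) (ENNReal.mul_lt_top hK hB)
    refine mul_le_mul' le_rfl ?_
    exact iSup_mono fun j => mul_le_of_le_one_left' (pow_le_one' hq.le _)
  · set p := ρ.toReal
    have hp : 0 < p := ENNReal.toReal_pos hρ.ne' hρ'
    set s := q ^ p
    have hs : s < 1 := ENNReal.rpow_lt_one hq hp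
    have h2 : ∀ n, A n ^ p ≤ (C * (2 * S)) ^ p * ∑' j : ℕ, s ^ d n j * B j ^ p := by
      intro n
      refine (ENNReal.rpow_le_rpow (h1 n) hp.le).trans ?_
      rw [ENNReal.mul_rpow_of_nonneg _ _ hp.le]
      gcongr
      have : (⨆ j, q ^ d n j * B j) ^ p = ⨆ j, (q ^ d n j * B j) ^ p :=
        (ENNReal.orderIsoRpow p hp).map_iSup _
      rw [this]
      refine iSup_le fun j => ?_
      rw [ENNReal.mul_rpow_of_nonneg _ _ hp.le, ← ENNReal.rpow_natCast, ← ENNReal.rpow_mul,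
        mul_comm _ p, ENNReal.rpow_mul, ENNReal.rpow_natCast]
      -- The `p`-th power of the supremum is at most the sum of the `p`-th powers.
      exact ENNReal.le_tsum (f := fun j => s ^ d n j * B j ^ p) j
    calc ∑' n, A n ^ p ≤ ∑' n, (C * (2 * S)) ^ p * ∑' j : ℕ, s ^ d n j * B j ^ p :=
          ENNReal.tsum_le_tsum h2
      _ = (C * (2 * S)) ^ p * ∑' j : ℕ, (∑' n, s ^ d n j) * B j ^ p := by
          rw [ENNReal.tsum_mul_left, ENNReal.tsum_comm]
          simp only [ENNReal.tsum_mul_right]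
      _ ≤ (C * (2 * S)) ^ p * ∑' j : ℕ, (2 * ∑' i : ℕ, s ^ i) * B j ^ p := by
          gcongr with j
          refine le_trans (le_of_eq ?_) (tsum_pow_dist_le s j)
          simp only [d, add_comm]
      _ = (C * (2 * S)) ^ p * ((2 * ∑' i : ℕ, s ^ i) * ∑' j : ℕ, B j ^ p) := by
          rw [ENNReal.tsum_mul_left]
      _ < ∞ := ENNReal.mul_lt_top (ENNReal.rpow_lt_top_of_nonneg hp.le hK.ne)
          (ENNReal.mul_lt_top (ENNReal.mul_lt_top (by simp) (tsum_geometric_lt_top hs)) hB)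

lemma inLp_of_shift {ρ : ℝ≥0∞} {A : ℕ → ℝ≥0∞} (m : ℕ) (hA : ∀ n, A n < ∞)
    (h : InLp ρ fun n => A (n + m)) : InLp ρ A := by
  rw [InLp] at h ⊢
  split_ifs at h ⊢
  · have hs : ∑ i ∈ Finset.range m, A i < ∞ := ENNReal.sum_lt_top.2 fun i _ => hA i
    refine lt_of_le_of_lt (iSup_le fun n => ?_) (ENNReal.add_lt_top.2 ⟨hs, h⟩)
    rcases lt_or_ge n m with hn | hn
    · exact (Finset.single_le_sum (f := A) (fun _ _ => zero_le) (Finset.mem_range.2 hn)).trans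
        le_self_add
    · obtain ⟨i, rfl⟩ := Nat.exists_eq_add_of_le' hn
      exact (le_iSup (fun i => A (i + m)) i).trans le_add_self
  · rw [← sum_range_add_tsum _ m]
    exact ENNReal.add_lt_top.2 ⟨ENNReal.sum_lt_top.2 fun i _ =>
      ENNReal.rpow_lt_top_of_nonneg ENNReal.toReal_nonneg (hA i).ne, h⟩

lemma InLp.add {ρ : ℝ≥0∞} {A B : ℕ → ℝ≥0∞} (hA : InLp ρ A) (hB : InLp ρ B) :
    InLp ρ fun n => A n + B n := by
  rw [InLp] at hA hB ⊢
  split_ifs at hA hB ⊢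
  · exact lt_of_le_of_lt (iSup_le fun n => add_le_add (le_iSup A n) (le_iSup B n))
      (ENNReal.add_lt_top.2 ⟨hA, hB⟩)
  · set p := ρ.toReal
    have hp : 0 ≤ p := ENNReal.toReal_nonneg
    have key : ∀ n, (A n + B n) ^ p ≤ 2 ^ p * (A n ^ p + B n ^ p) := by
      intro n
      have : A n + B n ≤ 2 * max (A n) (B n) := by
        rw [two_mul]; exact add_le_add (le_max_left _ _) (le_max_right _ _)
      refine (ENNReal.rpow_le_rpow this hp).trans ?_
      rw [ENNReal.mul_rpow_of_nonneg _ _ hp]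
      gcongr
      rcases max_choice (A n) (B n) with h | h <;> rw [h]
      · exact le_self_add
      · exact le_add_self
    refine lt_of_le_of_lt (ENNReal.tsum_le_tsum key) ?_
    rw [ENNReal.tsum_mul_left, ENNReal.tsum_add]
    exact ENNReal.mul_lt_top (ENNReal.rpow_lt_top_of_nonneg hp (by simp))
      (ENNReal.add_lt_top.2 ⟨hA, hB⟩)

/-! ### Hardy inequalities for tails and heads -/

section SeqSpace

variable {ρ : ℝ≥0∞} {γ : ℝ} {a b : ℕ → ℝ≥0∞}

lemma two_rpow_add (s t : ℝ) : (2 : ℝ≥0∞) ^ (s + t) = 2 ^ s * 2 ^ t :=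
  ENNReal.rpow_add _ _ (by simp) (by simp)

lemma two_rpow_lt_one {ε : ℝ} (hε : 0 < ε) : (2 : ℝ≥0∞) ^ (-ε) < 1 :=
  ENNReal.rpow_lt_one_of_one_lt_of_neg (by simp) (by simpa using hε)

lemma two_rpow_half_mul_pow (ε : ℝ) (i : ℕ) :
    ((2 : ℝ≥0∞) ^ (-(ε / 2)) * 2 ^ (-(ε / 2))) ^ i = 2 ^ (-(i * ε)) := by
  rw [← two_rpow_add, ← ENNReal.rpow_natCast, ← ENNReal.rpow_mul]
  congr 1
  ring

/-- With `B n = 2 ^ (n * γ) * b n`, the term `2 ^ (n * γ) * b (n + i)` is `2 ^ (-(i * γ)) * B (n +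
i)`, a geometric convolution because `γ > 0`. -/
lemma seqSpace_of_le_tail (hρ : 0 < ρ) (hγ : 0 < γ) {C : ℝ≥0∞} (hC : C ≠ ∞)
    (hb : b ∈ seqSpace ρ γ) (h : ∀ n, a n ≤ C * ∑' i, b (n + i)) : a ∈ seqSpace ρ γ := by
  rw [mem_seqSpace_iff hρ] at hb ⊢
  refine inLp_of_le_tsum hρ (two_rpow_lt_one (half_pos hγ)) hC hb fun n => ?_
  set B : ℕ → ℝ≥0∞ := fun n => 2 ^ (n * γ) * b n
  calc (2 : ℝ≥0∞) ^ (n * γ) * a n ≤ 2 ^ (n * γ) * (C * ∑' i, b (n + i)) := by gcongr; exact h n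
    _ = C * ∑' i, 2 ^ (n * γ) * b (n + i) := by rw [ENNReal.tsum_mul_left]; ring
    _ = C * ∑' i : ℕ, ((2 : ℝ≥0∞) ^ (-(γ / 2)) * 2 ^ (-(γ / 2))) ^ ((n - (n + i)) + (n + i - n))
          * B (n + i) := by
        congr 2
        ext i
        rw [two_rpow_half_mul_pow, ← mul_assoc, ← two_rpow_add]
        congr 2
        rw [show n - (n + i) + (n + i - n) = i by omega]
        push_cast
        ring
    _ ≤ _ := by
        refine mul_le_mul' le_rfl ?_
        exact ENNReal.tsum_comp_le_tsum_of_injective (add_right_injective n) fun j =>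
          ((2 : ℝ≥0∞) ^ (-(γ / 2)) * 2 ^ (-(γ / 2))) ^ ((n - j) + (j - n)) * B j

lemma seqSpace_of_le (hρ : 0 < ρ) (hγ : 0 < γ) {C : ℝ≥0∞} (hC : C ≠ ∞)
    (hb : b ∈ seqSpace ρ γ) (h : ∀ n, a n ≤ C * b n) : a ∈ seqSpace ρ γ :=
  seqSpace_of_le_tail hρ hγ hC hb fun n => (h n).trans (by
    gcongr
    exact ENNReal.le_tsum (f := fun i => b (n + i)) 0)

/-- After weighting, the `j`-th term carries the factor `2 ^ (-((n - j) * (r - γ)))`, which decays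
because `γ < r`. -/
lemma seqSpace_of_le_head (hρ : 0 < ρ) {r : ℕ} (hr : γ < r) {C : ℝ≥0∞} (hC : C ≠ ∞)
    (hb : b ∈ seqSpace ρ γ)
    (h : ∀ n, 2 ^ (n * r) * a n ≤ C * ∑ j ∈ Finset.range (n + 1), 2 ^ (j * r) * b j) :
    a ∈ seqSpace ρ γ := by
  rw [mem_seqSpace_iff hρ] at hb ⊢
  refine inLp_of_le_tsum hρ (two_rpow_lt_one (half_pos (sub_pos.2 hr))) hC hb fun n => ?_
  have hpow : ∀ n : ℕ, (2 : ℝ≥0∞) ^ (n * r) = 2 ^ ((n : ℝ) * r) := fun n => by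
    rw [← Nat.cast_mul, ENNReal.rpow_natCast]
  calc (2 : ℝ≥0∞) ^ (n * γ) * a n
      = 2 ^ (n * γ - n * r) * (2 ^ (n * r) * a n) := by
        rw [hpow, ← mul_assoc, ← two_rpow_add, sub_add_cancel]
    _ ≤ 2 ^ (n * γ - n * r) * (C * ∑ j ∈ Finset.range (n + 1), 2 ^ (j * r) * b j) := by
        exact mul_le_mul' le_rfl (h n)
    _ = C * ∑ j ∈ Finset.range (n + 1), 2 ^ (n * γ - n * r) * (2 ^ (j * r) * b j) := by
        rw [← Finset.mul_sum]; ring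
    _ = C * ∑ j ∈ Finset.range (n + 1),
          ((2 : ℝ≥0∞) ^ (-((r - γ) / 2)) * 2 ^ (-((r - γ) / 2))) ^ ((n - j) + (j - n))
            * (2 ^ (j * γ) * b j) := by
        congr 1
        refine Finset.sum_congr rfl fun j hj => ?_
        have hj' : j ≤ n := Nat.le_of_lt_succ (Finset.mem_range.1 hj)
        rw [two_rpow_half_mul_pow, hpow, ← mul_assoc, ← mul_assoc, ← two_rpow_add, ← two_rpow_add]
        congr 2
        rw [show n - j + (j - n) = n - j by omega, Nat.cast_sub hj']
        ring
    _ ≤ _ := mul_le_mul' le_rfl (ENNReal.sum_le_tsum _)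

lemma seqSpace_of_le_shift (hρ : 0 < ρ) (hγ : 0 < γ) {C : ℝ≥0∞} (hC : C ≠ ∞) (m : ℕ)
    (ha : ∀ n, a n < ∞) (hb : b ∈ seqSpace ρ γ) (h : ∀ n, a (n + m) ≤ C * b n) :
    a ∈ seqSpace ρ γ := by
  have hfin : ∀ t : ℝ, (2 : ℝ≥0∞) ^ t < ∞ := fun t =>
    (ENNReal.rpow_ne_top_of_ne_zero (by simp) (by simp)).lt_top
  have h1 : (fun n => 2 ^ (m * γ) * a (n + m)) ∈ seqSpace ρ γ := by
    refine seqSpace_of_le hρ hγ (C := 2 ^ (m * γ) * C) (ENNReal.mul_ne_top (hfin _).ne hC) hb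
      fun n => ?_
    rw [mul_assoc]
    gcongr
    exact h n
  rw [mem_seqSpace_iff hρ] at h1 ⊢
  refine inLp_of_shift m (fun n => ENNReal.mul_lt_top (hfin _) (ha n)) ?_
  convert h1 using 2 with n
  rw [← mul_assoc, ← two_rpow_add]
  push_cast
  rw [add_mul]

lemma seqSpace_add (hρ : 0 < ρ) (ha : a ∈ seqSpace ρ γ) (hb : b ∈ seqSpace ρ γ) :
    (fun n => a n + b n) ∈ seqSpace ρ γ := by
  rw [mem_seqSpace_iff hρ] at ha hb ⊢
  simpa only [mul_add] using ha.add hb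

end SeqSpace

/-! ### Admissible partitions of unity -/

section PartialSum

variable {Ω : Set (ℕ × ℕ)} {g : ℕ → ℕ × ℕ → ℝ}

lemma partialSum_zero (g : ℕ → ℕ × ℕ → ℝ) : partialSum g 0 = g 0 := by
  ext k; simp [partialSum]

lemma partialSum_succ (g : ℕ → ℕ × ℕ → ℝ) (n : ℕ) (k : ℕ × ℕ) :
    partialSum g (n + 1) k = partialSum g n k + g (n + 1) k := Finset.sum_range_succ _ _

lemma IsAdmissible.le_partialSum (hg : IsAdmissible Ω g) {j n : ℕ} (hj : j ≤ n) (k : ℕ × ℕ) :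
    g j k ≤ partialSum g n k :=
  Finset.single_le_sum (f := fun j => g j k) (fun i _ => (hg.mem_Icc i k).1)
    (Finset.mem_range.2 (Nat.lt_succ_of_le hj))

lemma IsAdmissible.partialSum_nonneg (hg : IsAdmissible Ω g) (n : ℕ) (k : ℕ × ℕ) :
    0 ≤ partialSum g n k := Finset.sum_nonneg fun i _ => (hg.mem_Icc i k).1

lemma IsAdmissible.partialSum_mono (hg : IsAdmissible Ω g) {m n : ℕ} (h : m ≤ n) (k : ℕ × ℕ) :
    partialSum g m k ≤ partialSum g n k :=
  Finset.sum_le_sum_of_subset_of_nonneg (Finset.range_subset_range.2 (by omega))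
    fun i _ _ => (hg.mem_Icc i k).1

lemma IsAdmissible.eq_zero_of_partialSum (hg : IsAdmissible Ω g) {j n : ℕ} (hj : j ≤ n)
    {k : ℕ × ℕ} (h : partialSum g n k = 0) : g j k = 0 :=
  le_antisymm (h ▸ hg.le_partialSum hj k) (hg.mem_Icc j k).1

lemma IsAdmissible.finite_support_partialSum (hg : IsAdmissible Ω g) (n : ℕ) :
    (Function.support (partialSum g n)).Finite := by
  refine ((Finset.range (n + 1)).finite_toSet.biUnion fun j _ => hg.finite_support j).subset
    fun k hk => ?_
  obtain ⟨j, hj, h⟩ := Finset.exists_ne_zero_of_sum_ne_zero hk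
  exact Set.mem_biUnion (Finset.mem_coe.2 hj) h

lemma IsAdmissible.exists_partialSum_pos (hg : IsAdmissible Ω g) {k : ℕ × ℕ} (hk : k ∈ Ω) :
    ∃ n, 0 < partialSum g n k := by
  by_contra! h
  have h0 : ∀ j, g j k = 0 := fun j =>
    hg.eq_zero_of_partialSum le_rfl (le_antisymm (h j) (hg.partialSum_nonneg j k))
  have := hg.hasSum k hk
  simp only [h0] at this
  exact zero_ne_one (hasSum_zero.unique this)

/-- Some `g j k` with `j ≤ n` is nonzero, so all `g j' k` with `j' > j + m` vanish, and the partial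
sum up to `N` is already the whole series. -/
lemma IsAdmissible.partialSum_eq_one (hg : IsAdmissible Ω g) {m : ℕ}
    (hm : ∀ j j', j + m < j' → ∀ k, g j k * g j' k = 0) {n N : ℕ} (hN : n + m ≤ N) {k : ℕ × ℕ}
    (hk : k ∈ Ω) (h : 0 < partialSum g n k) : partialSum g N k = 1 := by
  obtain ⟨j, hj, h0⟩ := Finset.exists_ne_zero_of_sum_ne_zero h.ne'
  have hj' := Finset.mem_range.1 hj
  refine (hasSum_sum_of_ne_finset_zero fun j' hj'' => ?_).unique (hg.hasSum k hk)
  rw [Finset.mem_range] at hj''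
  exact (mul_eq_zero.1 (hm j j' (by omega) k)).resolve_left h0

end PartialSum

/-! ### The operators `σ_n` and `τ_j` as multipliers -/

namespace DigraphRep

variable {D : DigraphRep} {g : ℕ → ℕ × ℕ → ℝ}

lemma sigma_eq_mult (D : DigraphRep) (g : ℕ → ℕ × ℕ → ℝ) (n : ℕ) (f : D.G → ℝ) :
    D.sigma g n f = D.mult (partialSum g n) f := by
  simp [sigma, mult, D.Omega_eq_univ]

lemma tau_eq_mult (hg : IsAdmissible D.Omega g) (j : ℕ) (f : D.G → ℝ) :
    D.tau g j f = D.mult (g j) f := by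
  cases j with
  | zero => rw [tau, sigma_eq_mult, partialSum_zero]
  | succ j =>
    rw [tau, sigma_eq_mult, sigma_eq_mult, ← D.mult_sub_symbol (hg.finite_support_partialSum _)
      (hg.finite_support_partialSum _)]
    congr 1
    ext k
    rw [partialSum_succ, add_sub_cancel_left]

lemma sigma_mem_F (hg : IsAdmissible D.Omega g) (n : ℕ) (f : D.G → ℝ) : D.sigma g n f ∈ D.F := by
  rw [sigma_eq_mult]; exact D.mult_mem_F (hg.finite_support_partialSum n) f

lemma sigma_mem_polys (hg : IsAdmissible D.Omega g) (n : ℕ) (f : D.G → ℝ) :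
    D.sigma g n f ∈ D.polys g n := by
  rw [sigma_eq_mult]
  refine D.mult_mem_span (hg.finite_support_partialSum n) f fun k hk => ⟨?_, ?_⟩
  · simp [D.Omega_eq_univ]
  · exact lt_of_le_of_ne (hg.partialSum_nonneg n k) (Ne.symm hk)

lemma sigma_sub (hg : IsAdmissible D.Omega g) (n : ℕ) {f f' : D.G → ℝ} (hf : f ∈ D.F)
    (hf' : f' ∈ D.F) : D.sigma g n (f - f') = D.sigma g n f - D.sigma g n f' := by
  simp only [sigma_eq_mult]
  exact D.mult_sub (hg.finite_support_partialSum n) hf hf'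

lemma enorm_coeff_le (D : DigraphRep) (f : D.G → ℝ) (k : ℕ × ℕ) :
    ‖D.coeff f k‖ₑ ≤ supNorm (D.psi k) * supNorm f :=
  calc ‖D.coeff f k‖ₑ ≤ ∫⁻ x, ‖f x * D.psi k x‖ₑ ∂D.ν := enorm_integral_le_lintegral_enorm _
    _ ≤ ∫⁻ _, supNorm (D.psi k) * supNorm f ∂D.ν := by
        refine lintegral_mono fun x => ?_
        rw [enorm_mul, mul_comm]
        exact mul_le_mul' (enorm_le_supNorm _ x) (enorm_le_supNorm _ x)
    _ = supNorm (D.psi k) * supNorm f := by simp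

/-- A crude bound for one fixed symbol. It serves `σ_0`, as the variation of `H_n` is controlled
only for `n ≥ 1`. -/
lemma exists_supNorm_mult_le (D : DigraphRep) {h : ℕ × ℕ → ℝ}
    (hh : (Function.support h).Finite) :
    ∃ C : ℝ≥0∞, C ≠ ∞ ∧ ∀ f, supNorm (D.mult h f) ≤ C * supNorm f := by
  refine ⟨∑ k ∈ hh.toFinset, ‖h k‖ₑ * supNorm (D.psi k) * supNorm (D.psi k),
    (ENNReal.sum_lt_top.2 fun k _ => ?_).ne, fun f => ?_⟩
  · have := D.supNorm_psi_lt_top k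
    exact ENNReal.mul_lt_top (ENNReal.mul_lt_top enorm_lt_top this) this
  · rw [D.mult_eq_sum_toFinset hh, Finset.sum_mul]
    refine (supNorm_sum_le _ _).trans (Finset.sum_le_sum fun k _ => ?_)
    rw [supNorm_smul, enorm_mul]
    calc _ ≤ ‖h k‖ₑ * (supNorm (D.psi k) * supNorm f) * supNorm (D.psi k) := by
          gcongr; exact D.enorm_coeff_le f k
      _ = _ := by ring

/-- The reconstruction operators are uniformly bounded. -/
lemma exists_supNorm_sigma_le (hg : IsAdmissible D.Omega g)
    (hH : ∃ C : ℝ≥0, ∀ n ≥ 1, variation (partialSum g n) ≤ C) :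
    ∃ C : ℝ≥0∞, C ≠ ∞ ∧ ∀ n, ∀ f ∈ D.F, supNorm (D.sigma g n f) ≤ C * supNorm f := by
  obtain ⟨C, hC⟩ := hH
  obtain ⟨C₀, hC₀, h₀⟩ := D.exists_supNorm_mult_le (hg.finite_support_partialSum 0)
  refine ⟨C₀ + 9 * C, by finiteness, fun n f hf => ?_⟩
  rw [sigma_eq_mult]
  rcases Nat.eq_zero_or_pos n with rfl | hn
  · exact (h₀ f).trans (by gcongr; exact le_self_add)
  · refine (D.supNorm_mult_le (hg.finite_support_partialSum n) hf).trans ?_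
    gcongr
    exact (mul_le_mul' le_rfl (hC n hn)).trans le_add_self

lemma mult_eq_self {h : ℕ × ℕ → ℝ} (hh : (Function.support h).Finite) {S : Set (ℕ × ℕ)}
    (hS : ∀ k ∈ S, h k = 1) {P : D.G → ℝ} (hP : P ∈ Submodule.span ℝ (D.psi '' S)) :
    D.mult h P = P := by
  rw [Finsupp.mem_span_image_iff_linearCombination] at hP
  obtain ⟨l, hl, rfl⟩ := hP
  have h1 : ∀ k ∈ l.support, h k = 1 := fun k hk => hS k (hl hk)
  have e : Finsupp.linearCombination ℝ D.psi l = ∑ k ∈ l.support, l k • D.psi k := rfl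
  rw [e, D.mult_eq_sum_toFinset hh]
  simp only [coeff_sum]
  refine (Finset.sum_subset_zero_on_sdiff (fun k hk => ?_) (fun k hk => ?_) fun k hk => ?_).symm
  · simp [h1 k hk]
  · simp only [Finset.mem_sdiff] at hk
    rw [if_neg hk.2, mul_zero, zero_smul]
  · rw [if_pos hk, h1 k hk, one_mul]

lemma polys_le_span (g : ℕ → ℕ × ℕ → ℝ) (n : ℕ) :
    D.polys g n ≤ Submodule.span ℝ (D.psi '' D.Omega) :=
  Submodule.span_mono (Set.image_mono fun _ hk => hk.1)

lemma polys_mono (hg : IsAdmissible D.Omega g) {m n : ℕ} (h : m ≤ n) :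
    D.polys g m ≤ D.polys g n :=
  Submodule.span_mono (Set.image_mono fun k hk => ⟨hk.1, hk.2.trans_le (hg.partialSum_mono h k)⟩)

lemma exists_mem_polys (hg : IsAdmissible D.Omega g) {P : D.G → ℝ}
    (hP : P ∈ Submodule.span ℝ (D.psi '' D.Omega)) : ∃ n, P ∈ D.polys g n := by
  induction hP using Submodule.span_induction with
  | mem x hx =>
    obtain ⟨k, hk, rfl⟩ := hx
    obtain ⟨n, hn⟩ := hg.exists_partialSum_pos hk
    exact ⟨n, Submodule.subset_span ⟨k, ⟨hk, hn⟩, rfl⟩⟩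
  | zero => exact ⟨0, Submodule.zero_mem _⟩
  | add x y _ _ h1 h2 =>
    obtain ⟨m, hm⟩ := h1
    obtain ⟨n, hn⟩ := h2
    exact ⟨max m n, Submodule.add_mem _ (polys_mono hg (le_max_left _ _) hm)
      (polys_mono hg (le_max_right _ _) hn)⟩
  | smul c x _ h => obtain ⟨n, hn⟩ := h; exact ⟨n, Submodule.smul_mem _ _ hn⟩

lemma sigma_eq_self (hg : IsAdmissible D.Omega g) {m : ℕ}
    (hm : ∀ j j', j + m < j' → ∀ k, g j k * g j' k = 0) {n N : ℕ} (hN : n + m ≤ N)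
    {P : D.G → ℝ} (hP : P ∈ D.polys g n) : D.sigma g N P = P := by
  rw [sigma_eq_mult]
  exact mult_eq_self (hg.finite_support_partialSum N)
    (fun k hk => hg.partialSum_eq_one hm hN hk.1 hk.2) hP

lemma degApprox_le_of_mem {n : ℕ} {f P : D.G → ℝ} (hP : P ∈ D.polys g n) :
    D.degApprox g n f ≤ supNorm (f - P) := iInf₂_le P hP

/-! ### Approximation by `σ_n(f)` -/

section Approximation

variable {C : ℝ≥0∞} {f : D.G → ℝ}

/-- Since `σ_N` fixes `P`, the error is unchanged when `f` is replaced by `f - P`. -/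
lemma supNorm_sub_sigma_le (hg : IsAdmissible D.Omega g) {m : ℕ}
    (hm : ∀ j j', j + m < j' → ∀ k, g j k * g j' k = 0)
    (hC : ∀ n, ∀ f ∈ D.F, supNorm (D.sigma g n f) ≤ C * supNorm f) (hf : f ∈ D.F)
    {n N : ℕ} (hN : n + m ≤ N) {P : D.G → ℝ} (hP : P ∈ D.polys g n) :
    supNorm (f - D.sigma g N f) ≤ (1 + C) * supNorm (f - P) := by
  have hPF := D.mem_F_of_mem_span (polys_le_span g n hP)
  have e : f - D.sigma g N f = (f - P) - D.sigma g N (f - P) := by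
    rw [sigma_sub hg N hf hPF, sigma_eq_self hg hm hN hP]; abel
  rw [e, add_mul, one_mul]
  exact (supNorm_sub_le _ _).trans (add_le_add le_rfl (hC N _ (D.sub_mem_F hf hPF)))

lemma supNorm_sub_sigma_le_degApprox (hg : IsAdmissible D.Omega g) {m : ℕ}
    (hm : ∀ j j', j + m < j' → ∀ k, g j k * g j' k = 0) (hC' : C ≠ ∞)
    (hC : ∀ n, ∀ f ∈ D.F, supNorm (D.sigma g n f) ≤ C * supNorm f) (hf : f ∈ D.F) (n : ℕ) :
    supNorm (f - D.sigma g (n + m) f) ≤ (1 + C) * D.degApprox g n f := by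
  have h0 : 1 + C ≠ 0 := by simp
  have h1 : 1 + C ≠ ∞ := by finiteness
  simp only [degApprox, ENNReal.mul_iInf_of_ne h0 h1]
  exact le_iInf₂ fun P hP => supNorm_sub_sigma_le hg hm hC hf le_rfl hP

lemma sigma_add_sum_tau (g : ℕ → ℕ × ℕ → ℝ) (f : D.G → ℝ) (n N : ℕ) :
    D.sigma g (n + N) f = D.sigma g n f + ∑ i ∈ Finset.range N, D.tau g (n + i + 1) f := by
  induction N with
  | zero => simp
  | succ N ih => rw [Finset.sum_range_succ, ← add_assoc, ← add_assoc, ← ih, tau]; abel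

/-- The expansion `f = ∑ τ_j(f)` converges uniformly. -/
lemma supNorm_sub_sigma_le_tsum (hg : IsAdmissible D.Omega g) (hC' : C ≠ ∞)
    (hC : ∀ n, ∀ f ∈ D.F, supNorm (D.sigma g n f) ≤ C * supNorm f) (hf : f ∈ D.F) (n : ℕ) :
    supNorm (f - D.sigma g n f) ≤ ∑' i, supNorm (D.tau g (n + i) f) := by
  obtain ⟨m, hm⟩ := hg.almost_disjoint
  refine ENNReal.le_of_forall_pos_le_add fun ε hε _ => ?_
  have h0 : 1 + C ≠ 0 := by simp
  have h1 : 1 + C ≠ ∞ := by finiteness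
  obtain ⟨P, hP, hPε⟩ := hf (ε / (1 + C))
    (ENNReal.div_pos (by exact_mod_cast hε.ne') h1)
  obtain ⟨N, hN⟩ := exists_mem_polys hg hP
  have h2 := supNorm_sub_sigma_le hg hm hC hf (N := n + (N + m)) (by omega) hN
  have h3 : supNorm (f - D.sigma g (n + (N + m)) f) ≤ ε :=
    h2.trans ((mul_le_mul' le_rfl hPε).trans (ENNReal.mul_div_cancel h0 h1).le)
  have e : f - D.sigma g n f = ∑ i ∈ Finset.range (N + m), D.tau g (n + i + 1) f +
      (f - D.sigma g (n + (N + m)) f) := by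
    rw [sigma_add_sum_tau]; abel
  rw [e]
  refine (supNorm_add_le _ _).trans (add_le_add ?_ h3)
  refine (supNorm_sum_le _ _).trans ((ENNReal.sum_le_tsum _).trans ?_)
  -- The telescoped sum starts at `τ_{n+1}`; the term `τ_n` in the bound is slack.
  exact ENNReal.tsum_comp_le_tsum_of_injective (add_left_injective 1)
    fun i => supNorm (D.tau g (n + i) f)

lemma supNorm_tau_le (hC : ∀ n, ∀ f ∈ D.F, supNorm (D.sigma g n f) ≤ C * supNorm f)
    (hf : f ∈ D.F) (j : ℕ) : supNorm (D.tau g j f) ≤ 2 * C * supNorm f := by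
  rw [mul_assoc, two_mul]
  cases j with
  | zero => exact (hC 0 f hf).trans le_self_add
  | succ j => exact (supNorm_sub_le _ _).trans (add_le_add (hC _ f hf) (hC _ f hf))

lemma supNorm_tau_succ_le (g : ℕ → ℕ × ℕ → ℝ) (f : D.G → ℝ) (j : ℕ) :
    supNorm (D.tau g (j + 1) f) ≤
      supNorm (f - D.sigma g j f) + supNorm (f - D.sigma g (j + 1) f) := by
  have : D.tau g (j + 1) f = (f - D.sigma g j f) - (f - D.sigma g (j + 1) f) := by
    rw [tau]; abel
  rw [this]
  exact supNorm_sub_le _ _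

/-! ### Derivatives and the K-functional -/

variable {r : ℕ} {μ : ℕ × ℕ → ℝ}

lemma finite_support_restrictTo (hg : IsAdmissible D.Omega g) (μ : ℕ × ℕ → ℝ) (j : ℕ) :
    (Function.support (restrictTo g μ j)).Finite :=
  (hg.finite_support j).subset fun k hk => by
    by_contra h
    exact hk (Set.indicator_of_notMem h μ)

lemma finite_support_recip (hg : IsAdmissible D.Omega g) (μ : ℕ × ℕ → ℝ) (j : ℕ) :
    (Function.support (recip (restrictTo g μ j))).Finite :=
  (finite_support_restrictTo hg μ j).subset fun k hk h => hk (by simp [recip, h])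

lemma restrictTo_of_ne_zero {j : ℕ} {k : ℕ × ℕ} (h : g j k ≠ 0) : restrictTo g μ j k = μ k :=
  Set.indicator_of_mem (s := Function.support (g j)) h μ

lemma multiplier_pos (hμ : IsMultiplier D.Omega g r μ) (k : ℕ × ℕ) : 0 < μ k :=
  hμ.pos k ⟨k, by simp [D.Omega_eq_univ], by simp, by simp⟩

/-- On the support of `g_j`, multiplication by `μ_j^{[-1]}` undoes the derivative; elsewhere `τ_j`
annihilates both sides. -/
lemma tau_eq_mult_recip (hg : IsAdmissible D.Omega g) (hμ : IsMultiplier D.Omega g r μ)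
    {u u' : D.G → ℝ} (hu : D.IsDerivative μ u u') (j : ℕ) :
    D.tau g j u = D.tau g j (D.mult (recip (restrictTo g μ j)) u') := by
  rw [tau_eq_mult hg, tau_eq_mult hg]
  refine D.mult_congr fun k => ?_
  rw [D.coeff_mult (finite_support_recip hg μ j), hu k]
  by_cases h : g j k = 0
  · simp [h]
  · rw [recip, restrictTo_of_ne_zero h, inv_mul_cancel_left₀ (multiplier_pos hμ k).ne']

/-- A Favard-type estimate: the `j`-th block of `u` is recovered from the derivative by a multiplier
of variation at most a constant times `2 ^ (-j * r)`. -/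
lemma exists_supNorm_tau_le_derivative (hg : IsAdmissible D.Omega g)
    (hμ : IsMultiplier D.Omega g r μ) (hC' : C ≠ ∞)
    (hC : ∀ n, ∀ f ∈ D.F, supNorm (D.sigma g n f) ≤ C * supNorm f) :
    ∃ A : ℝ≥0∞, A ≠ ∞ ∧ ∀ u u' : D.G → ℝ, u' ∈ D.F → D.IsDerivative μ u u' → ∀ j,
      supNorm (D.tau g j u) ≤ A * (2 ^ (j * r))⁻¹ * supNorm u' := by
  obtain ⟨c, _, hc, hcC⟩ := hμ.equiv
  have hc0 : (c : ℝ≥0∞) ≠ 0 := by exact_mod_cast hc.ne'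
  refine ⟨2 * C * (9 * (c : ℝ≥0∞)⁻¹), ?_, fun u u' hu' hd j => ?_⟩
  · exact ENNReal.mul_ne_top (by finiteness)
      (ENNReal.mul_ne_top (by simp) (ENNReal.inv_ne_top.2 hc0))
  · have hV : variation (recip (restrictTo g μ j)) ≤ (c : ℝ≥0∞)⁻¹ * (2 ^ (j * r))⁻¹ := by
      rw [← ENNReal.mul_inv (Or.inl hc0) (Or.inl ENNReal.coe_ne_top)]
      exact ENNReal.le_inv_iff_le_inv.1 (hcC j).2.2.1
    rw [tau_eq_mult_recip hg hμ hd j]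
    have hfin := finite_support_recip hg μ j
    calc _ ≤ 2 * C * supNorm (D.mult (recip (restrictTo g μ j)) u') :=
          supNorm_tau_le hC (D.mult_mem_F hfin u') j
      _ ≤ 2 * C * (9 * ((c : ℝ≥0∞)⁻¹ * (2 ^ (j * r))⁻¹) * supNorm u') := by
          gcongr
          exact (D.supNorm_mult_le hfin hu').trans (by gcongr)
      _ = _ := by ring

lemma tsum_inv_two_pow_le (hr : 1 ≤ r) (n : ℕ) :
    ∑' i : ℕ, ((2 : ℝ≥0∞) ^ ((n + i) * r))⁻¹ ≤ 2 * (2 ^ (n * r))⁻¹ := by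
  have h2 : ∑' i : ℕ, (2⁻¹ : ℝ≥0∞) ^ i = 2 := by
    rw [ENNReal.tsum_geometric, ENNReal.one_sub_inv_two, inv_inv]
  calc ∑' i : ℕ, ((2 : ℝ≥0∞) ^ ((n + i) * r))⁻¹
      ≤ ∑' i : ℕ, (2⁻¹ : ℝ≥0∞) ^ i * (2 ^ (n * r))⁻¹ := by
        refine ENNReal.tsum_le_tsum fun i => ?_
        rw [add_mul, pow_add, ENNReal.mul_inv (by simp) (by simp), mul_comm]
        refine mul_le_mul' ?_ le_rfl
        rw [ENNReal.inv_pow]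
        exact pow_le_pow_right_of_le_one' (ENNReal.inv_le_one.2 one_le_two)
          (Nat.le_mul_of_pos_right i hr)
    _ = 2 * (2 ^ (n * r))⁻¹ := by rw [ENNReal.tsum_mul_right, h2]

lemma ofReal_inv_two_pow (n r : ℕ) :
    ENNReal.ofReal (((2 : ℝ)⁻¹ ^ n) ^ r) = ((2 : ℝ≥0∞) ^ (n * r))⁻¹ := by
  rw [← pow_mul, ENNReal.ofReal_pow (by positivity), ENNReal.ofReal_inv_of_pos two_pos,
    ENNReal.ofReal_ofNat, ENNReal.inv_pow]

/-- The direct estimate: the degree of approximation is bounded by the K-functional. -/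
lemma exists_degApprox_le_kFunctional (hg : IsAdmissible D.Omega g) (hr : 1 ≤ r)
    (hμ : IsMultiplier D.Omega g r μ) (hC' : C ≠ ∞)
    (hC : ∀ n, ∀ f ∈ D.F, supNorm (D.sigma g n f) ≤ C * supNorm f) :
    ∃ A : ℝ≥0∞, A ≠ ∞ ∧ ∀ (f : D.G → ℝ) (n : ℕ),
      D.degApprox g n f ≤ A * D.kFunctional μ r f (2⁻¹ ^ n) := by
  obtain ⟨A, hA, h⟩ := exists_supNorm_tau_le_derivative hg hμ hC' hC
  have h1 : 1 + A * 2 ≠ ∞ := by finiteness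
  have h0 : 1 + A * 2 ≠ 0 := by simp
  refine ⟨1 + A * 2, h1, fun f n => ?_⟩
  simp only [kFunctional, ENNReal.mul_iInf_of_ne h0 h1, ofReal_inv_two_pow]
  refine le_iInf₂ fun u hu => le_iInf₂ fun u' hu' => le_iInf fun hd => ?_
  -- For a competitor `u`, the element `σ_n(u)` of `ℙ_n` approximates `f`; the blocks of `u` beyond
  -- `n` sum geometrically because `r ≥ 1`.
  have e : f - D.sigma g n u = (f - u) + (u - D.sigma g n u) := by abel
  calc D.degApprox g n f ≤ supNorm (f - D.sigma g n u) :=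
        degApprox_le_of_mem (sigma_mem_polys hg n u)
    _ ≤ supNorm (f - u) + ∑' i, supNorm (D.tau g (n + i) u) := by
        rw [e]
        exact (supNorm_add_le _ _).trans
          (add_le_add le_rfl (supNorm_sub_sigma_le_tsum hg hC' hC hu n))
    _ ≤ supNorm (f - u) + ∑' i : ℕ, A * ((2 : ℝ≥0∞) ^ ((n + i) * r))⁻¹ * supNorm u' :=
        add_le_add le_rfl (ENNReal.tsum_le_tsum fun i => h u u' hu' hd (n + i))
    _ ≤ supNorm (f - u) + A * 2 * ((2 ^ (n * r))⁻¹ * supNorm u') := by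
        rw [ENNReal.tsum_mul_right, ENNReal.tsum_mul_left, ← mul_assoc]
        refine add_le_add le_rfl (mul_le_mul' ?_ le_rfl)
        rw [mul_assoc]
        exact mul_le_mul' le_rfl (tsum_inv_two_pow_le hr n)
    _ ≤ _ := by
        rw [mul_add]
        gcongr
        · exact le_mul_of_one_le_left' le_self_add
        · exact le_add_self

/-- The derivative of `σ_n(f)`. -/
def sigmaDeriv (D : DigraphRep) (g : ℕ → ℕ × ℕ → ℝ) (μ : ℕ × ℕ → ℝ) (n : ℕ) (f : D.G → ℝ) :
    D.G → ℝ := D.mult (fun k => μ k * partialSum g n k) f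

lemma finite_support_mul_partialSum (hg : IsAdmissible D.Omega g) (μ : ℕ × ℕ → ℝ) (n : ℕ) :
    (Function.support fun k => μ k * partialSum g n k).Finite :=
  (hg.finite_support_partialSum n).subset fun k hk h => hk (by simp [h])

lemma isDerivative_sigmaDeriv (hg : IsAdmissible D.Omega g) (μ : ℕ × ℕ → ℝ) (n : ℕ)
    (f : D.G → ℝ) : D.IsDerivative μ (D.sigma g n f) (D.sigmaDeriv g μ n f) := by
  intro k
  rw [sigmaDeriv, D.coeff_mult (finite_support_mul_partialSum hg μ n), sigma_eq_mult,
    D.coeff_mult (hg.finite_support_partialSum n), mul_assoc]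

/-- On the support of `g_j` the sequence `μ` is `μ_j`, so the derivative of each block costs only
the variation of `μ_j`. This gives the Bernstein-type bound that follows. -/
lemma sigmaDeriv_eq_sum (hg : IsAdmissible D.Omega g) (μ : ℕ × ℕ → ℝ) (n : ℕ) (f : D.G → ℝ) :
    D.sigmaDeriv g μ n f =
      ∑ j ∈ Finset.range (n + 1), D.mult (restrictTo g μ j) (D.tau g j f) := by
  set s := (hg.finite_support_partialSum n).toFinset with hs_def
  have hs : ∀ k ∉ s, partialSum g n k = 0 := fun k hk => by simpa [s] using hk
  rw [sigmaDeriv, D.mult_eq_sum (s := s) fun k hk => by simp [hs k hk]]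
  have e : ∀ j ∈ Finset.range (n + 1), D.mult (restrictTo g μ j) (D.tau g j f) =
      ∑ k ∈ s, (μ k * g j k * D.coeff f k) • D.psi k := by
    intro j hj
    have hj' := Nat.le_of_lt_succ (Finset.mem_range.1 hj)
    rw [← D.mult_eq_sum (h := fun k => μ k * g j k) (s := s) fun k hk => by
      simp [hg.eq_zero_of_partialSum hj' (hs k hk)]]
    refine D.mult_congr fun k => ?_
    rw [tau_eq_mult hg, D.coeff_mult (hg.finite_support j)]
    by_cases h : g j k = 0
    · simp [h]
    · rw [restrictTo_of_ne_zero h, mul_assoc]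
  rw [Finset.sum_congr rfl e, Finset.sum_comm]
  refine Finset.sum_congr rfl fun k _ => ?_
  rw [← Finset.sum_smul, ← Finset.sum_mul, ← Finset.mul_sum, partialSum]

lemma exists_supNorm_sigmaDeriv_le (hg : IsAdmissible D.Omega g)
    (hμ : IsMultiplier D.Omega g r μ) :
    ∃ A : ℝ≥0∞, A ≠ ∞ ∧ ∀ (f : D.G → ℝ) (n : ℕ), supNorm (D.sigmaDeriv g μ n f) ≤
      A * ∑ j ∈ Finset.range (n + 1), 2 ^ (j * r) * supNorm (D.tau g j f) := by
  obtain ⟨_, B, _, hB⟩ := hμ.equiv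
  refine ⟨9 * B, by finiteness, fun f n => ?_⟩
  rw [sigmaDeriv_eq_sum hg, Finset.mul_sum]
  refine (supNorm_sum_le _ _).trans (Finset.sum_le_sum fun j _ => ?_)
  have hF : D.tau g j f ∈ D.F := by
    rw [tau_eq_mult hg]; exact D.mult_mem_F (hg.finite_support j) f
  calc _ ≤ 9 * variation (restrictTo g μ j) * supNorm (D.tau g j f) :=
        D.supNorm_mult_le (finite_support_restrictTo hg μ j) hF
    _ ≤ 9 * (B * 2 ^ (j * r)) * supNorm (D.tau g j f) := by gcongr; exact (hB j).2.1
    _ = _ := by ring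

/-- The competitor is `u = σ_n(f)`. -/
lemma kFunctional_le (hg : IsAdmissible D.Omega g) (μ : ℕ × ℕ → ℝ) (r n : ℕ) (f : D.G → ℝ) :
    D.kFunctional μ r f (2⁻¹ ^ n) ≤
      supNorm (f - D.sigma g n f) + (2 ^ (n * r))⁻¹ * supNorm (D.sigmaDeriv g μ n f) := by
  rw [kFunctional, ofReal_inv_two_pow]
  exact iInf₂_le_of_le _ (sigma_mem_F hg n f) (iInf₂_le_of_le _
    (D.mult_mem_F (finite_support_mul_partialSum hg μ n) f)
    (iInf_le _ (isDerivative_sigmaDeriv hg μ n f)))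

end Approximation

end DigraphRep

end DigraphHarmonic

end

/-! ### The equivalence theorem -/

open DigraphHarmonic DigraphHarmonic.DigraphRep

theorem mainTheorem3 (D : DigraphHarmonic.DigraphRep)
    (g : ℕ → ℕ × ℕ → ℝ) (hg : DigraphHarmonic.IsAdmissible D.Omega g)
    (hH : ∃ C : ℝ≥0, ∀ n ≥ 1,
      DigraphHarmonic.variation (DigraphHarmonic.partialSum g n) ≤ C)
    (r : ℕ) (hr : 1 ≤ r) (μ : ℕ × ℕ → ℝ)
    (hμ : DigraphHarmonic.IsMultiplier D.Omega g r μ)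
    (ρ : ℝ≥0∞) (hρ : 0 < ρ) (γ : ℝ) (hγ : 0 < γ)
    (f : D.G → ℝ) (hf : f ∈ D.F) :
    List.TFAE [
      f ∈ D.besov g ρ γ,
      (fun j => DigraphHarmonic.supNorm (D.tau g j f)) ∈ DigraphHarmonic.seqSpace ρ γ,
      (fun n => DigraphHarmonic.supNorm (f - D.sigma g n f)) ∈ DigraphHarmonic.seqSpace ρ γ] ∧
    (γ < r →
      (f ∈ D.besov g ρ γ ↔
        (fun j : ℕ => D.kFunctional μ r f (2⁻¹ ^ j)) ∈ DigraphHarmonic.seqSpace ρ γ)) := by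
  obtain ⟨C, hC', hC⟩ := exists_supNorm_sigma_le hg hH
  have hfin : ∀ n, supNorm (f - D.sigma g n f) < ∞ := fun n =>
    D.supNorm_lt_top (D.sub_mem_F hf (sigma_mem_F hg n f))
  have h13 : f ∈ D.besov g ρ γ → (fun n => supNorm (f - D.sigma g n f)) ∈ seqSpace ρ γ := by
    intro h
    obtain ⟨m, hm⟩ := hg.almost_disjoint
    exact seqSpace_of_le_shift hρ hγ (C := 1 + C) (by finiteness) m hfin h.2
      (supNorm_sub_sigma_le_degApprox hg hm hC' hC hf)
  have h31 : (fun n => supNorm (f - D.sigma g n f)) ∈ seqSpace ρ γ → f ∈ D.besov g ρ γ :=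
    fun h => ⟨hf, seqSpace_of_le hρ hγ ENNReal.one_ne_top h fun n => by
      rw [one_mul]; exact degApprox_le_of_mem (sigma_mem_polys hg n f)⟩
  have h32 : (fun n => supNorm (f - D.sigma g n f)) ∈ seqSpace ρ γ →
      (fun j => supNorm (D.tau g j f)) ∈ seqSpace ρ γ := by
    intro h
    -- `τ_{j+1}(f)` is the difference of two consecutive errors. Each is a term of the tail starting
    -- at `j`, hence the constant `2`; `τ_0(f)` is restored by a shift.
    have h' : (fun j => supNorm (D.tau g (j + 1) f)) ∈ seqSpace ρ γ := by
      refine seqSpace_of_le_tail hρ hγ (C := 2) (by simp) h fun j => ?_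
      refine (supNorm_tau_succ_le g f j).trans ?_
      rw [two_mul]
      exact add_le_add (ENNReal.le_tsum (f := fun i => supNorm (f - D.sigma g (j + i) f)) 0)
        (ENNReal.le_tsum (f := fun i => supNorm (f - D.sigma g (j + i) f)) 1)
    refine seqSpace_of_le_shift hρ hγ ENNReal.one_ne_top 1 (fun j => ?_) h' fun j => by
      rw [one_mul]
    rw [tau_eq_mult hg]
    exact D.supNorm_lt_top (D.mult_mem_F (hg.finite_support j) f)
  have h23 : (fun j => supNorm (D.tau g j f)) ∈ seqSpace ρ γ →
      (fun n => supNorm (f - D.sigma g n f)) ∈ seqSpace ρ γ := fun h =>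
    seqSpace_of_le_tail hρ hγ ENNReal.one_ne_top h fun n => by
      rw [one_mul]; exact supNorm_sub_sigma_le_tsum hg hC' hC hf n
  refine ⟨?_, fun hγr => ⟨fun h => ?_, fun h => ?_⟩⟩
  · tfae_have 1 → 3 := h13
    tfae_have 3 → 1 := h31
    tfae_have 3 → 2 := h32
    tfae_have 2 → 3 := h23
    tfae_finish
  · obtain ⟨A, hA, hd⟩ := exists_supNorm_sigmaDeriv_le hg hμ
    have h3 := h13 h
    -- This is the only place where `γ < r` enters: the derivative of `σ_n(f)` is bounded by a head
    -- sum of the `τ_j(f)`.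
    have h4 : (fun n : ℕ => ((2 : ℝ≥0∞) ^ (n * r))⁻¹ * supNorm (D.sigmaDeriv g μ n f)) ∈
        seqSpace ρ γ := by
      refine seqSpace_of_le_head hρ hγr hA (h32 h3) fun n => ?_
      rw [ENNReal.mul_inv_cancel_left (by simp) (by simp)]
      exact hd f n
    refine seqSpace_of_le hρ hγ ENNReal.one_ne_top (seqSpace_add hρ h3 h4) fun n => ?_
    rw [one_mul]
    exact kFunctional_le hg μ r n f
  · obtain ⟨A, hA, hK⟩ := exists_degApprox_le_kFunctional hg hr hμ hC' hC
    exact ⟨hf, seqSpace_of_le hρ hγ hA h fun n => hK f n⟩
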